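/- Let $X=\mathrm{Spec}\,R$ be a conical symplectic variety: $R$ is a finitely generated normal integral domain over $\mathbf{C}$ with a grading $R=\bigoplus_{i\ge 0}R_i$, $R_0=\mathbf{C}$; the smooth part $X_{reg}$ carries a symplectic (closed, nondegenerate, algebraic) 2-form $\omega$ which extends to a regular 2-form on some resolution $\tilde X\to X$; and $\omega$ is homogeneous for the $\mathbf{C}^*$-action defined by the grading ($t^*f=t^i f$ for $f\in R_i$), that is, $t^*\omega=t^{l}\omega$ for all $t\in\mathbf{C}^*$ and some integer $l=:wt(\omega)$. Assume that $X$ has maximal weight $1$, that is, the maximum of the degrees of the elements of a (non-empty) minimal set of homogeneous generators of the $\mathbf{C}$-algebra $R$ is $1$. Then: 1. $wt(\omega)=1$ or $wt(\omega)=2$. 2. If $wt(\omega)=2$, then for some $d$ the pair $(X,\omega)$ is isomorphic to $(\mathbf{C}^{2d},\omega_{st})$, where $\omega_{st}=\sum_{i=1}^d dz_i\wedge dz_{i+d}$, by an isomorphism that identifies $\omega$ with $\omega_{st}$ and is equivariant for the given $\mathbf{C}^*$-action on $X$ and the scaling action on $\mathbf{C}^{2d}$. 3. $X$ is singular if and only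 if $wt(\omega)=1$. -/

import Mathlib

noncomputable section

namespace ConicalSymplectic

open AlgebraicGeometry CategoryTheory

section RationalForms

variable (K : Type) [Field K] [Algebra ℂ K]

/-- Rational vector fields on a complex variety with function field `K`. -/
abbrev VectorField : Type := Derivation ℂ K K

/-- Rational 1-forms: `K`-linear functionals on rational vector fields. -/
abbrev OneForm : Type := VectorField K →ₗ[K] K

/-- Rational 2-tensors; a rational 2-form is an alternating one. In characteristic zero, for `K`
finitely generated over `ℂ`, the alternating ones are exactly the elements of the second exterior
power of the Kähler differentials of `K` over `ℂ`. -/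
abbrev TwoForm : Type := VectorField K →ₗ[K] VectorField K →ₗ[K] K

variable {K}

/-- The differential `da`, that is, `D ↦ D a`. -/
def dOne (a : K) : OneForm K where
  toFun D := D a
  map_add' _ _ := rfl
  map_smul' _ _ := rfl

/-- `(α ∧ β)(D, D') = α(D) β(D') - β(D) α(D')`. -/
def wedge (α β : OneForm K) : TwoForm K :=
  α.smulRight β - β.smulRight α

/-- `dω = 0`, by Cartan's formula for the exterior derivative. -/
def IsClosedForm (ω : TwoForm K) : Prop :=
  ∀ D₁ D₂ D₃ : VectorField K,
    D₁ (ω D₂ D₃) - D₂ (ω D₁ D₃) + D₃ (ω D₁ D₂)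
      - ω ⁅D₁, D₂⁆ D₃ + ω ⁅D₁, D₃⁆ D₂ - ω ⁅D₂, D₃⁆ D₁ = 0

/-- For a local ring `A` inside `K`: the vector fields that are regular along `A`. -/
def regularVectorFields (A : Subring K) : Set (VectorField K) :=
  {D | ∀ a ∈ A, D a ∈ A}

/-- The 1-forms regular along `A`: the image of the Kähler differentials of `A`. -/
def regularOneForms (A : Subring K) : Submodule A (OneForm K) :=
  Submodule.span A {α | ∃ a ∈ A, α = dOne a}

/-- The 2-forms regular along `A`: the image of the second exterior power of the Kähler
differentials of `A`. -/
def regularTwoForms (A : Subring K) : Submodule A (TwoForm K) :=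
  Submodule.span A {η | ∃ a ∈ A, ∃ b ∈ A, η = wedge (dOne a) (dOne b)}

/-- `ω` is nondegenerate at a smooth point with local ring `A`: contraction with `ω` is a bijection
from regular vector fields to regular 1-forms at this point. -/
def IsNondegenerateAlong (A : Subring K) (ω : TwoForm K) : Prop :=
  Set.BijOn (fun D => ω D) (regularVectorFields A) (regularOneForms A)

variable {L : Type} [Field L] [Algebra ℂ L]

/-- The vector field `σ⁻¹ ∘ D ∘ σ` on `K` for a vector field `D` on `L` and `σ : K ≃ L`. -/
def conjVectorField (σ : K ≃ₐ[ℂ] L) (D : VectorField L) : VectorField K :=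
  Derivation.mk' (σ.symm.toLinearMap ∘ₗ D.toLinearMap ∘ₗ σ.toLinearMap) (by
    intro a b
    simp)

theorem conjVectorField_apply (σ : K ≃ₐ[ℂ] L) (D : VectorField L) (a : K) :
    conjVectorField σ D a = σ.symm (D (σ a)) := rfl

/-- Pullback of 2-forms under the (birational) map whose comorphism is `σ : K ≃ L`. It takes
`f da ∧ db` to `σ(f) dσ(a) ∧ dσ(b)`. -/
def pullback (σ : K ≃ₐ[ℂ] L) (ω : TwoForm K) : TwoForm L :=
  LinearMap.mk₂ L (fun D D' => σ (ω (conjVectorField σ D) (conjVectorField σ D')))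
    (by
      intro D₁ D₂ D'
      have h : conjVectorField σ (D₁ + D₂) = conjVectorField σ D₁ + conjVectorField σ D₂ := by
        ext a; simp [conjVectorField_apply]
      simp [h])
    (by
      intro c D D'
      have h : conjVectorField σ (c • D) = σ.symm c • conjVectorField σ D := by
        ext a; simp [conjVectorField_apply]
      simp [h])
    (by
      intro D D₁ D₂
      have h : conjVectorField σ (D₁ + D₂) = conjVectorField σ D₁ + conjVectorField σ D₂ := by
        ext a; simp [conjVectorField_apply]
      simp [h])
    (by
      intro c D D'
      have h : conjVectorField σ (c • D') = σ.symm c • conjVectorField σ D' := by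
        ext a; simp [conjVectorField_apply]
      simp [h])

end RationalForms

section Torus

variable {R : Type} [CommRing R] [Algebra ℂ R]

variable (𝒜 : ℕ → Submodule ℂ R) [GradedAlgebra 𝒜]

/-- The comorphism `t^* : R → R` of the action of `t`, with `t^* f = t ^ i f` for `f` of
degree `i`. -/
def torusHom (t : ℂˣ) : R →ₐ[ℂ] R :=
  (DirectSum.toAlgebra ℂ (fun i => 𝒜 i) (fun i => ((t : ℂ) ^ i) • (𝒜 i).subtype)
    (by simp)
    (by intro i j a b; simp [pow_add, smul_smul, mul_comm])).comp
    (DirectSum.decomposeAlgEquiv 𝒜).toAlgHom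

theorem torusHom_apply (t : ℂˣ) (i : ℕ) (f : R) (hf : f ∈ 𝒜 i) :
    torusHom 𝒜 t f = (t : ℂ) ^ i • f := by
  simp only [torusHom, AlgHom.comp_apply]
  change DirectSum.toAlgebra ℂ (fun i => 𝒜 i) _ _ _ (DirectSum.decompose 𝒜 f) = _
  rw [DirectSum.decompose_of_mem 𝒜 hf]
  exact DirectSum.toAddMonoid_of (β := fun i => 𝒜 i)
    (fun i => (((t : ℂ) ^ i) • (𝒜 i).subtype).toAddMonoidHom) i ⟨f, hf⟩

theorem torusHom_comp (s t : ℂˣ) (h : s * t = 1) :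
    (torusHom 𝒜 s).comp (torusHom 𝒜 t) = AlgHom.id ℂ R := by
  have h' : (s : ℂ) * t = 1 := by rw [← Units.val_mul, h, Units.val_one]
  ext f
  induction f using DirectSum.Decomposition.inductionOn 𝒜 with
  | zero => simp
  | homogeneous f =>
    rw [AlgHom.comp_apply, torusHom_apply 𝒜 t _ _ f.2, map_smul, torusHom_apply 𝒜 s _ _ f.2,
      smul_smul, ← mul_pow, mul_comm, h']
    simp
  | add a b ha hb => rw [map_add, ha, hb, map_add]

/-- The action of `ℂˣ` on `R` given by the grading. -/
def torusAction (t : ℂˣ) : R ≃ₐ[ℂ] R :=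
  AlgEquiv.ofAlgHom (torusHom 𝒜 t) (torusHom 𝒜 t⁻¹)
    (torusHom_comp 𝒜 t t⁻¹ (by simp)) (torusHom_comp 𝒜 t⁻¹ t (by simp))

end Torus

section Variety

variable (R : Type) [CommRing R] [IsDomain R] [Algebra ℂ R]

/-- The local ring of `Spec R` at `p`, inside the function field. -/
def localRing (p : PrimeSpectrum R) : Subring (FractionRing R) :=
  (Localization.subalgebra.ofField (FractionRing R) p.asIdeal.primeCompl
    p.asIdeal.primeCompl_le_nonZeroDivisors).toSubring

/-- The smooth part of `Spec R`. -/
abbrev smoothPart : Set (PrimeSpectrum R) := Algebra.smoothLocus ℂ R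

/-- `Spec R` is singular. -/
def IsSingular : Prop := smoothPart R ≠ Set.univ

/-- `ω` is a symplectic 2-form on the smooth part of `Spec R`: a closed algebraic 2-form, regular
and nondegenerate at each point. -/
structure IsSymplecticForm (ω : TwoForm (FractionRing R)) : Prop where
  alternating : ω.IsAlt
  closed : IsClosedForm ω
  regular : ∀ p ∈ smoothPart R, ω ∈ regularTwoForms (localRing R p)
  nondegenerate : ∀ p ∈ smoothPart R, IsNondegenerateAlong (localRing R p) ω

/-- Functions on `Spec R` as rational functions on an integral scheme `Y` over `Spec R`. -/
def toFunctionField (Y : Scheme.{0}) [IsIntegral Y] (π : Y ⟶ Spec (CommRingCat.of R)) :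
    R →+* Y.functionField :=
  haveI : Nonempty (⊤ : Y.Opens) := ⟨⟨genericPoint Y, trivial⟩⟩
  ((Y.germToFunctionField ⊤).hom.comp π.appTop.hom).comp
    (Scheme.ΓSpecIso (CommRingCat.of R)).inv.hom

/-- A resolution of singularities of `Spec R`: an integral scheme `Y`, smooth over `ℂ`, with a
proper birational morphism to `Spec R`. Birationality is expressed by the isomorphism of function
fields that `π` induces; `birational_algebraMap` says that it is this one. -/
structure Resolution where
  Y : Scheme.{0}
  isIntegral : IsIntegral Y
  π : Y ⟶ Spec (CommRingCat.of R)
  proper : IsProper π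
  smooth : AlgebraicGeometry.Smooth (π ≫ Spec.map (CommRingCat.ofHom (algebraMap ℂ R)))
  birational : FractionRing R ≃+* Y.functionField
  birational_algebraMap : ∀ r : R,
    birational (algebraMap R (FractionRing R) r) = toFunctionField R Y π r

variable {R}

/-- The local ring of `Y` at `y`, inside the common function field of `Y` and `Spec R`. -/
def Resolution.localRing (ρ : Resolution R) (y : ρ.Y) : Subring (FractionRing R) :=
  haveI := ρ.isIntegral
  (algebraMap (ρ.Y.presheaf.stalk y) ρ.Y.functionField).range.comap ρ.birational.toRingHom

/-- `ω` extends to a 2-form on the whole resolution. -/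
def ExtendsTo (ω : TwoForm (FractionRing R)) (ρ : Resolution R) : Prop :=
  ∀ y : ρ.Y, ω ∈ regularTwoForms (ρ.localRing y)

variable (𝒜 : ℕ → Submodule ℂ R) [GradedAlgebra 𝒜]

/-- `ω` is homogeneous of weight `l`: `t^* ω = t ^ l ω` for all `t`. -/
def HasWeight (ω : TwoForm (FractionRing R)) (l : ℤ) : Prop :=
  ∀ t : ℂˣ,
    pullback (IsFractionRing.fieldEquivOfAlgEquiv ℂ (FractionRing R) (FractionRing R)
        (torusAction 𝒜 t)) ω
      = algebraMap ℂ (FractionRing R) ((t : ℂ) ^ l) • ω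

/-- `(Spec R, ω)`, with the grading `𝒜` of `R`, is a conical symplectic variety. -/
structure IsConicalSymplecticVariety (ω : TwoForm (FractionRing R)) : Prop where
  finiteType : Algebra.FiniteType ℂ R
  normal : IsIntegrallyClosed R
  degree_zero : 𝒜 0 = 1
  symplectic : IsSymplecticForm R ω
  homogeneous : ∃ l : ℤ, HasWeight 𝒜 ω l
  extends_resolution : ∃ ρ : Resolution R, ExtendsTo ω ρ

/-- The maximal weight is `N`: some minimal system of homogeneous generators `x₀, …, xₙ` of the
`ℂ`-algebra `R`, of degrees `a₀, …, aₙ`, has `max aᵢ = N`. -/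
def HasMaximalWeight (N : ℕ) : Prop :=
  ∃ (n : ℕ) (x : Fin (n + 1) → R) (a : Fin (n + 1) → ℕ),
    (∀ i, x i ∈ 𝒜 (a i)) ∧
    Algebra.adjoin ℂ (Set.range x) = ⊤ ∧
    (∀ i, x i ∉ Algebra.adjoin ℂ (x '' {j | j ≠ i})) ∧
    Finset.univ.sup a = N

end Variety

section AffineSpace

/-- The coordinate ring of the affine space `ℂ^{2d}`. The coordinates `z_1, …, z_d` are indexed by
the left summand, `z_{d+1}, …, z_{2d}` by the right one. -/
abbrev AffineRing (d : ℕ) : Type := MvPolynomial (Fin d ⊕ Fin d) ℂ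

/-- The coordinates as rational functions. -/
def coord {d : ℕ} (i : Fin d ⊕ Fin d) : FractionRing (AffineRing d) :=
  algebraMap (AffineRing d) (FractionRing (AffineRing d)) (MvPolynomial.X i)

/-- The standard symplectic form `∑ dz_i ∧ dz_{i+d}`. -/
def standardForm (d : ℕ) : TwoForm (FractionRing (AffineRing d)) :=
  ∑ i : Fin d, wedge (dOne (coord (Sum.inl i))) (dOne (coord (Sum.inr i)))

/-- `(Spec R, ω)` is isomorphic to `(ℂ^{2d}, ω_st)`: the isomorphism is compatible with the
`ℂˣ`-actions (the scaling action on `ℂ^{2d}`) and identifies the forms. -/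
def IsIsomorphicToStandard {R : Type} [CommRing R] [IsDomain R] [Algebra ℂ R]
    (𝒜 : ℕ → Submodule ℂ R) (ω : TwoForm (FractionRing R)) (d : ℕ) : Prop :=
  ∃ e : R ≃ₐ[ℂ] AffineRing d,
    (∀ (i : ℕ) (f : R), f ∈ 𝒜 i ↔ (e f).IsHomogeneous i) ∧
    pullback (IsFractionRing.fieldEquivOfAlgEquiv ℂ (FractionRing R)
      (FractionRing (AffineRing d)) e) ω = standardForm d

end AffineSpace

end ConicalSymplectic

end

/-! Let E be the Euler field, H_f the Hamiltonian field with ω(H_f, ·) = df, and v the valuation of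
the function field whose value at f ∈ R is the least degree of a nonzero homogeneous component.
Maximal weight one makes R generated by finitely many elements of degree one; let F ≠ 0 be one of
them. If ω has weight l, then H_f g has degree deg f + deg g − l.

Lower bound (`one_le_weight`). The valuation ring of v contains R, so by properness it has a center
y on the resolution, and ω is a combination of forms da ∧ db whose coefficients and a, b all have v
≥ 0. The field E raises v from 0 to at least 1, and F^(l-1) H_F preserves v ≥ 0, so ω(E, F^(l-1)
H_F) = -F^l has v ≥ 1. As v(F) = 1, this gives l ≥ 1.

Upper bound (`weight_le_two`). X is normal, hence smooth in codimension one, and brackets of regular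
functions are regular. Brackets of generators have degree 2 − l. If l > 2 they vanish, so H_F = 0
and F = E F = ω(H_F, E) = 0, which is absurd.

Weight two (`isIsomorphicToStandard_of_weight_two`). The brackets of generators are constants and
form a symplectic form on their span. For a symplectic basis the Hamiltonian fields are, up to sign,
the partial derivatives; hence the basis is algebraically independent, R is a polynomial ring and ω
is standard.

Weight one (`isSingular_of_weight_one`). All brackets vanish at the vertex. If the vertex were
smooth, nondegeneracy would make every regular vector field vanish there, whereas at a smooth point
some regular field does not kill F to first order. -/

noncomputable section

namespace ConicalSymplectic

/-! ### Centers of valuations on a resolution. -/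

section ResolutionCenter

open AlgebraicGeometry CategoryTheory

/-- Existence of a center, for a valuation ring of the function field of a proper scheme. -/
theorem exists_stalk_factor_valuationSubring {Y : Scheme.{0}} [IsIntegral Y] {S : CommRingCat.{0}}
    (π : Y ⟶ Spec S) [IsProper π] {K : Type} [Field K] (V : ValuationSubring K)
    (b : Y.presheaf.stalk (genericPoint Y) ⟶ .of K) (j : S ⟶ .of V)
    (hj : Spec.map b ≫ Y.fromSpecStalk (genericPoint Y) ≫ π =
      Spec.map (j ≫ CommRingCat.ofHom (algebraMap V K))) :
    ∃ (y : Y) (θ : Y.presheaf.stalk y ⟶ .of V),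
      θ ≫ CommRingCat.ofHom (algebraMap V K) =
        Y.presheaf.stalkSpecializes ((genericPoint_spec Y).specializes (Set.mem_univ y)) ≫ b := by
  have hcomm : CommSq (Spec.map b ≫ Y.fromSpecStalk (genericPoint Y))
      (Spec.map (CommRingCat.ofHom (algebraMap V K))) π (Spec.map j) :=
    ⟨by rw [Category.assoc, hj, Spec.map_comp]⟩
  have hprop : ValuativeCriterion π := by
    have h : IsProper π := inferInstance
    rw [IsProper.eq_valuativeCriterion] at h
    exact h.1.1.1
  obtain ⟨⟨g, hg, -⟩⟩ := (hprop.existence ⟨V, K, _, _, hcomm⟩).exists_lift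
  change Spec (.of V) ⟶ Y at g
  -- The center is the image of the closed point under the lift given by the valuative criterion.
  refine ⟨g (IsLocalRing.closedPoint V), Scheme.stalkClosedPointTo g, Spec.map_injective ?_⟩
  rw [← cancel_mono (Y.fromSpecStalk (g (IsLocalRing.closedPoint V))), Spec.map_comp,
    Spec.map_comp, Category.assoc, Category.assoc, Scheme.SpecMap_stalkSpecializes_fromSpecStalk]
  exact (congrArg _ (Scheme.Spec_stalkClosedPointTo_fromSpecStalk g)).trans hg

/-- A morphism to an affine scheme is determined by its effect on global sections; this turns the
commuting square of the valuative criterion into an identity of ring maps. -/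
theorem specMap_fromSpecStalk_comp {Y : Scheme.{0}} {S : CommRingCat.{0}}
    (π : Y ⟶ Spec S) {y : Y} {T : CommRingCat.{0}} (b : Y.presheaf.stalk y ⟶ T) :
    Spec.map b ≫ Y.fromSpecStalk y ≫ π =
      Spec.map ((Scheme.ΓSpecIso S).inv ≫ π.appTop ≫ Y.presheaf.germ ⊤ y trivial ≫ b) := by
  apply ext_of_isAffine
  have h : (Y.fromSpecStalk y).appTop =
      Y.presheaf.germ ⊤ y trivial ≫ (Scheme.ΓSpecIso (Y.presheaf.stalk y)).inv := by
    rw [Scheme.fromSpecStalk_appTop]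
    exact congrArg (_ ≫ ·)
      ((congrArg (_ ≫ ·) (CategoryTheory.Functor.map_id _ _)).trans (Category.comp_id _))
  rw [← cancel_epi (Scheme.ΓSpecIso S).inv, ← Scheme.ΓSpecIso_inv_naturality]
  simp only [Scheme.Hom.comp_appTop, Category.assoc]
  rw [h, Scheme.ΓSpecIso_inv_naturality b, Category.assoc]

variable {R : Type} [CommRing R] [IsDomain R] [Algebra ℂ R]

/-- Since V contains R, the generic point of Y extends to Spec V → Spec R, and properness lifts this
map to Y. Only inclusion of the local ring is needed, not domination. -/
theorem Resolution.exists_localRing_le (ρ : Resolution R) (V : ValuationSubring (FractionRing R))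
    (hV : ∀ r : R, algebraMap R (FractionRing R) r ∈ V) :
    ∃ y : ρ.Y, ρ.localRing y ≤ V.toSubring := by
  have := ρ.isIntegral
  have := ρ.proper
  obtain ⟨y, θ, hθ⟩ := exists_stalk_factor_valuationSubring ρ.π V
    (CommRingCat.ofHom (ρ.birational.symm : ρ.Y.functionField →+* FractionRing R))
    (CommRingCat.ofHom ((algebraMap R (FractionRing R)).codRestrict V hV)) (by
      refine (specMap_fromSpecStalk_comp _ _).trans (congrArg Spec.map ?_)
      ext r
      change ρ.birational.symm (toFunctionField R ρ.Y ρ.π r) = algebraMap R (FractionRing R) r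
      rw [← ρ.birational_algebraMap, ρ.birational.symm_apply_apply])
  refine ⟨y, fun x hx => ?_⟩
  obtain ⟨s, hs⟩ := hx
  have h : ((θ.hom s : V) : FractionRing R) = x := by
    have := congr($(hθ).hom s)
    refine this.trans ?_
    change ρ.birational.symm (algebraMap (ρ.Y.presheaf.stalk y) ρ.Y.functionField s) = x
    rw [hs]
    exact ρ.birational.symm_apply_apply x
  rw [← h]
  exact (θ.hom s).2

end ResolutionCenter

/-! ### Derivations, smoothness in codimension one, and extension of functions on normal varieties.
-/

section CommutativeAlgebra

/-- Localization is formally étale, so the differentials of K are the base change of those of B. -/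
theorem exists_derivation_extending {k B K : Type*} [CommRing k] [CommRing B] [Algebra k B]
    [Field K] [Algebra k K] [Algebra B K] [IsScalarTower k B K] [IsFractionRing B K]
    (D : Derivation k B K) :
    ∃ D' : Derivation k K K, ∀ b : B, D' (algebraMap B K b) = D b := by
  have : Algebra.FormallyEtale B K := .of_isLocalization (nonZeroDivisors B)
  let e := KaehlerDifferential.tensorKaehlerEquivOfFormallyEtale k B K
  let ψ : Ω[K⁄k] →ₗ[K] K := (D.liftKaehlerDifferential.liftBaseChange K) ∘ₗ e.symm.toLinearMap
  refine ⟨ψ.compDer (KaehlerDifferential.D k K), fun b => ?_⟩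
  have h : e.symm (KaehlerDifferential.D k K (algebraMap B K b)) =
      1 ⊗ₜ KaehlerDifferential.D k B b := by
    rw [LinearEquiv.symm_apply_eq, KaehlerDifferential.tensorKaehlerEquivOfFormallyEtale_apply]
    simp
  change (D.liftKaehlerDifferential.liftBaseChange K) (e.symm _) = _
  refine (congrArg _ h).trans ?_
  simp

theorem derivation_eq_of_eqOn_algebraMap {k : Type*} (B : Type*) {K : Type*} [CommRing k]
    [CommRing B] [Field K] [Algebra k K] [Algebra B K] [IsFractionRing B K]
    {D D' : Derivation k K K} (h : ∀ b : B, D (algebraMap B K b) = D' (algebraMap B K b)) :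
    D = D' := by
  ext x
  obtain ⟨a, b, -, rfl⟩ := IsFractionRing.div_surjective (A := B) x
  simp [Derivation.leibniz_div, h]

/-- The local ring at the generic point is the function field, a finitely generated extension of a
perfect field. -/
theorem bot_mem_smoothLocus {k R : Type*} [Field k] [PerfectField k] [CommRing R] [IsDomain R]
    [Algebra k R] [Algebra.FiniteType k R] : (⊥ : PrimeSpectrum R) ∈ Algebra.smoothLocus k R := by
  change Algebra.FormallySmooth k (Localization.AtPrime (⊥ : Ideal R))
  have h : (⊥ : Ideal R).primeCompl = nonZeroDivisors R := by
    ext; simp [Ideal.primeCompl]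
  have : IsLocalization (⊥ : Ideal R).primeCompl (FractionRing R) := by
    rw [h]; infer_instance
  have : Algebra.EssFiniteType k (FractionRing R) :=
    inferInstanceAs (Algebra.EssFiniteType k (Localization _))
  have : Algebra.FormallySmooth k (FractionRing R) := inferInstance
  exact .of_equiv ((IsLocalization.algEquiv (⊥ : Ideal R).primeCompl (FractionRing R)
    (Localization.AtPrime (⊥ : Ideal R))).restrictScalars k)

-- The closed fibre is A modulo its maximal ideal, a field essentially of finite type over a field
-- of characteristic zero, hence a separable extension.
open TensorProduct IsLocalRing in
theorem formallySmooth_residueField_tensor_of_map_maximalIdeal {k B A : Type*} [Field k]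
    [CharZero k] [CommRing B] [CommRing A] [Algebra k B] [Algebra k A] [Algebra B A]
    [IsScalarTower k B A] [IsLocalRing A] [IsLocalRing B] [IsLocalHom (algebraMap B A)]
    [Algebra.EssFiniteType k A]
    (h : (maximalIdeal B).map (algebraMap B A) = maximalIdeal A) :
    Algebra.FormallySmooth (ResidueField B) (ResidueField B ⊗[B] A) := by
  have : CharZero (ResidueField B) := charZero_of_injective_algebraMap
    (algebraMap k (ResidueField B)).injective
  have : IsScalarTower k (ResidueField B) (ResidueField A) := .of_algebraMap_eq' <| by
    rw [IsScalarTower.algebraMap_eq k B (ResidueField B), ← RingHom.comp_assoc,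
      ← IsScalarTower.algebraMap_eq B (ResidueField B) (ResidueField A),
      ← IsScalarTower.algebraMap_eq]
  have : Algebra.EssFiniteType k (ResidueField A) :=
    inferInstanceAs (Algebra.EssFiniteType k (A ⧸ maximalIdeal A))
  have : Algebra.EssFiniteType (ResidueField B) (ResidueField A) := .of_comp k _ _
  let g : ResidueField B ⊗[B] A →ₐ[ResidueField B] ResidueField A :=
    Algebra.TensorProduct.lift (Algebra.ofId _ _) (IsScalarTower.toAlgHom B A (ResidueField A))
      fun _ _ => .all _ _
  have hsurj : ∀ x : ResidueField B ⊗[B] A, ∃ a : A, x = 1 ⊗ₜ a := fun x => by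
    induction x with
    | zero => exact ⟨0, by simp⟩
    | tmul b a =>
      obtain ⟨b, rfl⟩ := residue_surjective b
      refine ⟨b • a, ?_⟩
      rw [← TensorProduct.smul_tmul, Algebra.smul_def, mul_one]
      rfl
    | add x y hx hy =>
      obtain ⟨a, rfl⟩ := hx
      obtain ⟨b, rfl⟩ := hy
      exact ⟨a + b, (TensorProduct.tmul_add _ _ _).symm⟩
  have hzero : ∀ a ∈ maximalIdeal A, (1 : ResidueField B) ⊗ₜ[B] a = 0 := by
    rw [← h]
    intro a ha
    induction ha using Submodule.span_induction with
    | mem a ha =>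
      obtain ⟨b, hb, rfl⟩ := ha
      have hb' : b • (1 : ResidueField B) = 0 := by
        rw [Algebra.smul_def, mul_one]
        exact (residue_eq_zero_iff b).mpr hb
      rw [Algebra.algebraMap_eq_smul_one, ← TensorProduct.smul_tmul, hb', TensorProduct.zero_tmul]
    | zero => simp
    | add x y _ _ hx hy => rw [TensorProduct.tmul_add, hx, hy, add_zero]
    | smul c x _ hx =>
      have : (1 : ResidueField B) ⊗ₜ[B] (c • x) = (1 ⊗ₜ c) * (1 ⊗ₜ x) := by simp
      rw [this, hx, mul_zero]
  have hg : Function.Bijective g := by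
    refine ⟨(injective_iff_map_eq_zero g).mpr fun x hx => ?_, fun y => ?_⟩
    · obtain ⟨a, rfl⟩ := hsurj x
      refine hzero a ((residue_eq_zero_iff a).mp ?_)
      simpa [g] using hx
    · obtain ⟨a, rfl⟩ := residue_surjective y
      exact ⟨1 ⊗ₜ a, by simp [g]⟩
  exact .of_equiv (AlgEquiv.ofBijective g hg).symm

theorem finitePresentation_of_isLocalization {P R B S : Type*} [CommRing P] [CommRing R]
    [Algebra P R] [Algebra.FinitePresentation P R] [CommRing B] [Algebra P B] [CommRing S]
    [Algebra R S] [Algebra P S] [Algebra B S] [IsScalarTower P R S] [IsScalarTower P B S]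
    (M : Submonoid P) [IsLocalization M B] [IsLocalization (Algebra.algebraMapSubmonoid R M) S] :
    Algebra.FinitePresentation B S := by
  have : Algebra.IsPushout P B R S := .symm <| Algebra.isPushout_of_isLocalization M _ _ _
  exact .equiv (Algebra.IsPushout.equiv P B R S)

-- A generator π of the maximal ideal defines k[X] → R, X ↦ π. It is flat because R is torsion-free
-- over a principal ideal domain, and the fibre over X = 0 at p is the residue field of p. The fibre
-- criterion gives smoothness over k[X] localized at X, hence over k.
open TensorProduct IsLocalRing in
theorem isSmoothAt_of_isPrincipal {k R : Type} [Field k] [CharZero k] [CommRing R]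
    [IsDomain R] [Algebra k R] [Algebra.FiniteType k R] (p : Ideal R) [p.IsPrime]
    (hp : (maximalIdeal (Localization.AtPrime p)).IsPrincipal) :
    Algebra.IsSmoothAt k p := by
  let A := Localization.AtPrime p
  change Algebra.FormallySmooth k A
  obtain ⟨π₀, hπ₀⟩ := hp
  rw [← Ideal.span] at hπ₀
  obtain ⟨π, s, hs⟩ := IsLocalization.exists_mk'_eq p.primeCompl π₀
  have hπ : maximalIdeal A = Ideal.span {algebraMap R A π} := by
    rw [hπ₀, Ideal.span_singleton_eq_span_singleton, ← hs]
    exact ⟨(IsLocalization.map_units A s).unit, IsLocalization.mk'_spec A π s⟩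
  have hcomap : ∀ x : R, x ∈ p ↔ algebraMap R A x ∈ maximalIdeal A := fun x => by
    rw [IsLocalization.AtPrime.to_map_mem_maximal_iff A p]
  by_cases hπ0 : π = 0
  · have hbot : p = ⊥ := by
      rw [eq_bot_iff]
      intro x hx
      rw [hcomap, hπ, hπ0, map_zero, Ideal.span_singleton_zero] at hx
      exact (IsLocalization.injective A p.primeCompl_le_nonZeroDivisors) (by simpa using hx)
    subst hbot
    exact bot_mem_smoothLocus (k := k) (R := R)
  let q : Ideal (Polynomial k) := Ideal.span {Polynomial.X}
  have hq : q.IsPrime := (Ideal.span_singleton_prime Polynomial.X_ne_zero).mpr Polynomial.prime_X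
  have hqm : q.IsMaximal := hq.isMaximal (by simp [q, Polynomial.X_ne_zero])
  let f : Polynomial k →ₐ[k] R := Polynomial.aeval π
  algebraize [f.toRingHom]
  have htower : IsScalarTower k (Polynomial k) R := .of_algebraMap_eq' f.comp_algebraMap.symm
  have hX : algebraMap (Polynomial k) R Polynomial.X = π := Polynomial.aeval_X π
  have hπp : π ∈ p := (hcomap π).mpr (hπ ▸ Ideal.mem_span_singleton_self _)
  have hover : p.LiesOver q := ⟨hqm.eq_of_le (Ideal.IsPrime.under _ p).ne_top (by
    rw [Ideal.span_singleton_le_iff_mem, Ideal.mem_comap, hX]; exact hπp)⟩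
  -- The kernel is a prime contained in (X). If nonzero it is maximal, hence equal to (X), which
  -- forces π = 0.
  have hinj : Function.Injective (algebraMap (Polynomial k) R) := by
    rw [injective_iff_map_eq_zero]
    by_contra! ⟨x, hx, hx0⟩
    have hker : (RingHom.ker (algebraMap (Polynomial k) R)).IsPrime := RingHom.ker_isPrime _
    have hker' : RingHom.ker (algebraMap (Polynomial k) R) ≤ q := by
      rw [hover.over]
      intro y hy
      rw [Ideal.mem_comap, (RingHom.mem_ker).mp hy]
      exact zero_mem p
    have := (hker.isMaximal (fun h0 => hx0 (by simpa [h0] using (RingHom.mem_ker).mpr hx))).eq_of_le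
      hq.ne_top hker'
    have hXk : Polynomial.X ∈ RingHom.ker (algebraMap (Polynomial k) R) :=
      this ▸ Ideal.mem_span_singleton_self _
    exact hπ0 (hX ▸ hXk)
  have : FaithfulSMul (Polynomial k) R := (faithfulSMul_iff_algebraMap_injective _ _).mpr hinj
  have : Module.IsTorsionFree (Polynomial k) R := inferInstance
  have : Module.Flat (Polynomial k) R := inferInstance
  have : Algebra.FiniteType (Polynomial k) R := .of_restrictScalars_finiteType k _ _
  have : Algebra.FinitePresentation (Polynomial k) R :=
    Algebra.FinitePresentation.of_finiteType.mp inferInstance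
  let B := Localization.AtPrime q
  let Sp := Localization (Algebra.algebraMapSubmonoid R q.primeCompl)
  let := Localization.AtPrime.algebraOfLiesOver q p
  let g : Sp →ₐ[R] A := IsLocalization.liftAlgHom
      (M := Algebra.algebraMapSubmonoid R q.primeCompl) (f := Algebra.ofId _ _) (by
    rintro ⟨_, x, hx, rfl⟩
    simpa using! IsLocalization.map_units (M := p.primeCompl) A ⟨algebraMap _ _ x,
      by simp_all [p.over_def q]⟩)
  algebraize [g.toRingHom]
  have : IsScalarTower (Polynomial k) Sp A := .to₁₃₄ _ R _ _
  have : IsScalarTower B Sp A := .of_algebraMap_eq' <| by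
    apply IsLocalization.ringHom_ext q.primeCompl
    simp only [RingHom.comp_assoc, ← IsScalarTower.algebraMap_eq]
  have : IsLocalization (Algebra.algebraMapSubmonoid Sp p.primeCompl) A :=
    .isLocalization_of_submonoid_le _ _ (Algebra.algebraMapSubmonoid R q.primeCompl) _
    (by rintro _ ⟨x, hx, rfl⟩; simp_all [p.over_def q])
  have : Algebra.FinitePresentation B Sp :=
    finitePresentation_of_isLocalization (P := Polynomial k) (R := R) q.primeCompl
  have : IsScalarTower k B A := .of_algebraMap_eq' <| by
    rw [IsScalarTower.algebraMap_eq k (Polynomial k) B, ← RingHom.comp_assoc,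
      ← IsScalarTower.algebraMap_eq (Polynomial k) B A, ← IsScalarTower.algebraMap_eq]
  have : Module.Flat B A := inferInstance
  have : IsLocalHom (algebraMap B A) := inferInstance
  have : Algebra.EssFiniteType k A := inferInstance
  have hmap : (maximalIdeal B).map (algebraMap B A) = maximalIdeal A := by
    rw [← Localization.AtPrime.map_eq_maximalIdeal, Ideal.map_map,
      ← IsScalarTower.algebraMap_eq (Polynomial k) B A, hπ, Ideal.map_span, Set.image_singleton,
      IsScalarTower.algebraMap_apply (Polynomial k) R A, hX]
  have := formallySmooth_residueField_tensor_of_map_maximalIdeal (k := k) hmap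
  have : Algebra.FormallySmooth B A := Algebra.FormallySmooth.of_formallySmooth_residueField_tensor
    (R := B) (S := A) (P := Sp) (Algebra.algebraMapSubmonoid _ p.primeCompl)
  have : Algebra.FormallySmooth k B := .comp k (Polynomial k) B
  exact .comp k B A

/-- If h ∉ R, its class in K/R has annihilator inside an associated prime p = (R : x). Integral
closedness makes the maximal ideal of the localization at p principal, and there h has a denominator
outside p, contradicting the choice of p. -/
theorem exists_algebraMap_eq_of_forall_isPrincipal {R K : Type*} [CommRing R] [IsDomain R]
    [IsNoetherianRing R] [IsIntegrallyClosed R] [Field K] [Algebra R K] [IsFractionRing R K]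
    (h : K) (H : ∀ (p : Ideal R) [p.IsPrime],
      (IsLocalRing.maximalIdeal (Localization.AtPrime p)).IsPrincipal →
      ∃ a s : R, s ∉ p ∧ h * algebraMap R K s = algebraMap R K a) :
    ∃ r : R, algebraMap R K r = h := by
  by_contra hR
  let N : Submodule R K := LinearMap.range (Algebra.linearMap R K)
  have hN : ∀ x : K, (N.mkQ x = 0) ↔ ∃ r : R, algebraMap R K r = x := fun x => by
    simp [N]
  obtain ⟨p, hp, hle⟩ := exists_le_isAssociatedPrime_of_isNoetherianRing R (N.mkQ h)
    (by rwa [Ne, hN])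
  obtain ⟨hpp, x', hx'⟩ := Submodule.isAssociatedPrime_iff.mp hp
  obtain ⟨x, rfl⟩ := N.mkQ_surjective x'
  have hcolon : ∀ (y : K) (r : R), r ∈ Submodule.colon (⊥ : Submodule R (K ⧸ N)) {N.mkQ y} ↔
      ∃ a, algebraMap R K a = algebraMap R K r * y := fun y r => by
    rw [Submodule.mem_colon_singleton, Submodule.mem_bot, ← map_smul, hN, Algebra.smul_def]
  have hmem : ∀ r : R, r ∈ p ↔ ∃ a, algebraMap R K a = algebraMap R K r * x := fun r => by
    rw [hx', hcolon]
  have hinj : Function.Injective (algebraMap R K) := IsFractionRing.injective R K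
  suffices hprin : (IsLocalRing.maximalIdeal (Localization.AtPrime p)).IsPrincipal by
    obtain ⟨a, s, hs, e⟩ := H p hprin
    exact hs (hle ((hcolon _ _).mpr ⟨a, by rw [← e, mul_comm]⟩))
  -- If x p ⊆ p, then x is integral over R by the determinant trick, so x ∈ R and p = R. Otherwise x
  -- y = u ∉ p for some y ∈ p, and y generates the maximal ideal after localization.
  by_cases hc : ∀ y ∈ p, ∃ z ∈ p, algebraMap R K z = algebraMap R K y * x
  · exfalso
    have hint : IsIntegral R x := by
      refine isIntegral_of_smul_mem_submodule (Submodule.map (Algebra.linearMap R K) p) ?_ ?_ x ?_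
      · obtain ⟨a, b, hb, hab⟩ := IsFractionRing.div_surjective (A := R) x
        have hb0 := IsFractionRing.to_map_ne_zero_of_mem_nonZeroDivisors (K := K) hb
        rw [Submodule.ne_bot_iff]
        refine ⟨algebraMap R K b, ⟨b, (hmem b).mpr ⟨a, ?_⟩, rfl⟩, hb0⟩
        rw [← hab, mul_div_cancel₀ _ hb0]
      · exact Submodule.FG.map _ (IsNoetherian.noetherian p)
      · rintro _ ⟨y, hy, rfl⟩
        obtain ⟨z, hz, e⟩ := hc y hy
        exact ⟨z, hz, by simpa [mul_comm] using e⟩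
    obtain ⟨r, hr⟩ := IsIntegrallyClosed.isIntegral_iff.mp hint
    exact hpp.ne_top ((Ideal.eq_top_iff_one _).mpr ((hmem 1).mpr ⟨r, by simpa using hr⟩))
  · push Not at hc
    obtain ⟨y, hy, hy'⟩ := hc
    obtain ⟨u, hu⟩ := (hmem y).mp hy
    have hup : u ∉ p := fun h' => hy' u h' hu
    have hunit := IsLocalization.map_units (Localization.AtPrime p) (⟨u, hup⟩ : p.primeCompl)
    refine ⟨algebraMap R _ y, le_antisymm ?_ ?_⟩
    · rw [← Localization.AtPrime.map_eq_maximalIdeal, Ideal.map_le_iff_le_comap]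
      intro z hz
      obtain ⟨c, hcz⟩ := (hmem z).mp hz
      have e : z * u = c * y := hinj (by rw [map_mul, map_mul, hu, hcz]; ring)
      rw [Ideal.mem_comap, ← Ideal.mul_unit_mem_iff_mem _ hunit, ← map_mul, e, map_mul]
      exact Ideal.mul_mem_left _ _ (Ideal.mem_span_singleton_self _)
    · rw [← Ideal.span, Ideal.span_singleton_le_iff_mem,
        ← Localization.AtPrime.map_eq_maximalIdeal]
      exact Ideal.mem_map_of_mem _ hy

end CommutativeAlgebra

/-! ### The coaction, the Euler field and homogeneous rational functions. -/

section Grading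

open Polynomial

variable {R : Type} [CommRing R] [Algebra ℂ R]
variable (𝒜 : ℕ → Submodule ℂ R) [GradedAlgebra 𝒜]

/-- The coaction `f ↦ ∑ fᵢ Tⁱ` of the multiplicative group. -/
def coaction : R →ₐ[ℂ] R[X] :=
  (DirectSum.toAlgebra ℂ (fun i => 𝒜 i)
    (fun i => ((monomial i : R →ₗ[R] R[X]).restrictScalars ℂ) ∘ₗ (𝒜 i).subtype)
    (by rfl)
    (by intro i j a b; simp [monomial_mul_monomial])).comp
    (DirectSum.decomposeAlgEquiv 𝒜).toAlgHom

theorem coaction_of_mem {i : ℕ} {f : R} (hf : f ∈ 𝒜 i) : coaction 𝒜 f = monomial i f := by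
  simp only [coaction, AlgHom.comp_apply]
  change DirectSum.toAlgebra ℂ (fun i => 𝒜 i) _ _ _ (DirectSum.decompose 𝒜 f) = _
  rw [DirectSum.decompose_of_mem 𝒜 hf]
  exact DirectSum.toAddMonoid_of (β := fun i => 𝒜 i)
    (fun i => (((monomial i : R →ₗ[R] R[X]).restrictScalars ℂ) ∘ₗ (𝒜 i).subtype).toAddMonoidHom)
    i ⟨f, hf⟩

theorem coeff_coaction (f : R) (i : ℕ) : (coaction 𝒜 f).coeff i = GradedAlgebra.proj 𝒜 i f := by
  induction f using DirectSum.Decomposition.inductionOn 𝒜 with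
  | zero => simp
  | @homogeneous j f =>
    rw [coaction_of_mem 𝒜 f.2, coeff_monomial, GradedAlgebra.proj_apply]
    split_ifs with h
    · subst h; simp
    · rw [DirectSum.decompose_of_mem_ne 𝒜 f.2 h]
  | add a b ha hb => rw [map_add, coeff_add, ha, hb, map_add]

theorem eval_coaction (t : ℂˣ) (f : R) :
    (coaction 𝒜 f).eval (algebraMap ℂ R t) = torusAction 𝒜 t f := by
  induction f using DirectSum.Decomposition.inductionOn 𝒜 with
  | zero => simp
  | @homogeneous j f =>
    rw [coaction_of_mem 𝒜 f.2, eval_monomial]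
    refine Eq.trans ?_ (torusHom_apply 𝒜 t j f f.2).symm
    rw [Algebra.smul_def, map_pow, mul_comm]
  | add a b ha hb => rw [map_add, eval_add, ha, hb, map_add]

theorem eval_one_coaction (f : R) : (coaction 𝒜 f).eval 1 = f := by
  induction f using DirectSum.Decomposition.inductionOn 𝒜 with
  | zero => simp
  | @homogeneous j f => rw [coaction_of_mem 𝒜 f.2, eval_monomial, one_pow, mul_one]
  | add a b ha hb => rw [map_add, eval_add, ha, hb]

theorem coaction_injective : Function.Injective (coaction 𝒜) := fun f g h => by
  rw [← eval_one_coaction 𝒜 f, h, eval_one_coaction]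

/-- The Euler vector field, multiplication by `i` in degree `i`. -/
def eulerDerivation : Derivation ℂ R R :=
  Derivation.mk'
    { toFun f := (derivative (coaction 𝒜 f)).eval 1
      map_add' := by simp
      map_smul' c f := by
        rw [map_smul, Algebra.smul_def, Polynomial.algebraMap_apply]
        simp [Algebra.smul_def] }
    (fun a b => by simp [eval_one_coaction]; ring)

theorem eulerDerivation_of_mem {i : ℕ} {f : R} (hf : f ∈ 𝒜 i) :
    eulerDerivation 𝒜 f = (i : R) * f := by
  change (derivative (coaction 𝒜 f)).eval 1 = _
  rw [coaction_of_mem 𝒜 hf, derivative_monomial, eval_monomial]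
  simp [mul_comm]

theorem proj_of_mem {i : ℕ} {f : R} (hf : f ∈ 𝒜 i) : GradedAlgebra.proj 𝒜 i f = f := by
  rw [GradedAlgebra.proj_apply, DirectSum.decompose_of_mem_same 𝒜 hf]

theorem proj_of_mem_ne {i j : ℕ} {f : R} (hf : f ∈ 𝒜 i) (hij : i ≠ j) :
    GradedAlgebra.proj 𝒜 j f = 0 := by
  rw [GradedAlgebra.proj_apply, DirectSum.decompose_of_mem_ne 𝒜 hf hij]

theorem proj_mem (i : ℕ) (f : R) : GradedAlgebra.proj 𝒜 i f ∈ 𝒜 i := by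
  rw [GradedAlgebra.proj_apply]; exact Subtype.property _

theorem proj_eulerDerivation (i : ℕ) (f : R) :
    GradedAlgebra.proj 𝒜 i (eulerDerivation 𝒜 f) = (i : R) * GradedAlgebra.proj 𝒜 i f := by
  induction f using DirectSum.Decomposition.inductionOn 𝒜 with
  | zero => simp
  | @homogeneous j f =>
    rw [eulerDerivation_of_mem 𝒜 f.2, ← nsmul_eq_mul, ← nsmul_eq_mul, map_nsmul]
    by_cases h : j = i
    · subst h; rfl
    · rw [proj_of_mem_ne 𝒜 f.2 h, smul_zero, smul_zero]
  | add a b ha hb => rw [map_add, map_add, ha, hb, map_add, mul_add]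

/-- The component of degree `n`, for an integer `n`. -/
def intProj (n : ℤ) (f : R) : R := if 0 ≤ n then GradedAlgebra.proj 𝒜 n.toNat f else 0

theorem intProj_natCast (n : ℕ) (f : R) : intProj 𝒜 n f = GradedAlgebra.proj 𝒜 n f := by
  simp [intProj]

theorem coeff_X_pow_mul_coaction_mul_C (N m : ℕ) (f g : R) :
    (X ^ N * coaction 𝒜 f * C g).coeff m = intProj 𝒜 (m - N) f * g := by
  rw [coeff_mul_C, coeff_X_pow_mul', intProj]
  by_cases h : N ≤ m
  · rw [if_pos h, if_pos (by omega), coeff_coaction]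
    congr 3
    omega
  · rw [if_neg h, if_neg (by omega)]

variable [IsDomain R]

/-- The hypothesis says that a/b is homogeneous of degree k; the conclusion lets a/b be rewritten as
the quotient of the components of degrees n + k and n. Both sides are polynomials in t up to a power
of t, so agreement at all nonzero t gives equality of coefficients. -/
theorem intProj_mul_eq {k : ℤ} {a b : R}
    (h : ∀ t : ℂˣ, torusAction 𝒜 t a * b = algebraMap ℂ R ((t : ℂ) ^ k) * (a * torusAction 𝒜 t b))
    (n : ℤ) : intProj 𝒜 (n + k) a * b = intProj 𝒜 n b * a := by
  -- k may be negative, so t^k is written as t^M / t^N with natural exponents.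
  obtain ⟨N, M, hNM⟩ : ∃ N M : ℕ, (M : ℤ) = N + k :=
    ⟨k.natAbs, (k.natAbs + k).toNat, by omega⟩
  have hpoly : X ^ N * coaction 𝒜 a * C b = X ^ M * coaction 𝒜 b * C a := by
    refine eq_of_infinite_eval_eq _ _ ?_
    refine ((Set.finite_singleton (0 : ℂ)).infinite_compl.image
      (algebraMap ℂ R).injective.injOn).mono ?_
    rintro _ ⟨t, ht, rfl⟩
    lift t to ℂˣ using IsUnit.mk0 t ht
    simp only [Set.mem_ofPred_eq, eval_mul, eval_pow, eval_X, eval_C, eval_coaction]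
    rw [mul_assoc, h t, ← map_pow, ← map_pow, ← zpow_natCast, ← zpow_natCast, hNM,
      zpow_add₀ t.ne_zero, map_mul]
    ring
  by_cases hn : 0 ≤ n + M
  · have := congrArg (fun p => p.coeff (n + M).toNat) hpoly
    simp only [coeff_X_pow_mul_coaction_mul_C] at this
    rw [Int.toNat_of_nonneg hn] at this
    convert this using 3 <;> omega
  · rw [intProj, intProj, if_neg (by omega), if_neg (by omega), zero_mul, zero_mul]

/-- The torus action on rational functions. -/
def fieldAction (t : ℂˣ) : FractionRing R ≃ₐ[ℂ] FractionRing R :=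
  IsFractionRing.fieldEquivOfAlgEquiv ℂ (FractionRing R) (FractionRing R) (torusAction 𝒜 t)

theorem fieldAction_algebraMap (t : ℂˣ) (f : R) :
    fieldAction 𝒜 t (algebraMap R (FractionRing R) f) =
      algebraMap R (FractionRing R) (torusAction 𝒜 t f) :=
  IsFractionRing.fieldEquivOfAlgEquiv_algebraMap ..

/-- Rational functions that are homogeneous of degree `k`. -/
def HasDegree (h : FractionRing R) (k : ℤ) : Prop :=
  ∀ t : ℂˣ, fieldAction 𝒜 t h = algebraMap ℂ (FractionRing R) ((t : ℂ) ^ k) * h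

theorem hasDegree_of_mem {i : ℕ} {f : R} (hf : f ∈ 𝒜 i) :
    HasDegree 𝒜 (algebraMap R (FractionRing R) f) i := fun t => by
  rw [fieldAction_algebraMap]
  have : torusAction 𝒜 t f = (t : ℂ) ^ i • f := torusHom_apply 𝒜 t i f hf
  rw [this, Algebra.smul_def, map_mul, ← IsScalarTower.algebraMap_apply, zpow_natCast]

theorem HasDegree.intProj_mul_eq {h : FractionRing R} {k : ℤ} (hh : HasDegree 𝒜 h k) {a b : R}
    (hab : h * algebraMap R (FractionRing R) b = algebraMap R (FractionRing R) a) (n : ℤ) :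
    intProj 𝒜 (n + k) a * b = intProj 𝒜 n b * a := by
  refine ConicalSymplectic.intProj_mul_eq 𝒜 (fun t => ?_) n
  apply IsFractionRing.injective R (FractionRing R)
  simp only [map_mul, ← fieldAction_algebraMap, ← hab, hh t, ← IsScalarTower.algebraMap_apply]
  ring

theorem HasDegree.mem_of_algebraMap {a : R} {k : ℕ}
    (ha : HasDegree 𝒜 (algebraMap R (FractionRing R) a) k) : a ∈ 𝒜 k := by
  have h := ha.intProj_mul_eq 𝒜 (a := a) (b := 1) (by simp) ((0 : ℕ) : ℤ)
  rw [intProj_natCast, proj_of_mem 𝒜 SetLike.GradedOne.one_mem, one_mul, mul_one, Nat.cast_zero,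
    zero_add, intProj_natCast] at h
  rw [← h]
  exact proj_mem 𝒜 k a

theorem HasDegree.eq_zero_of_algebraMap {a : R} {k : ℤ} (hk : k < 0)
    (ha : HasDegree 𝒜 (algebraMap R (FractionRing R) a) k) : a = 0 := by
  have h := ha.intProj_mul_eq 𝒜 (a := a) (b := 1) (by simp) ((0 : ℕ) : ℤ)
  rw [intProj_natCast, proj_of_mem 𝒜 SetLike.GradedOne.one_mem, one_mul, mul_one, Nat.cast_zero,
    zero_add, intProj, if_neg (by omega)] at h
  exact h.symm

end Grading

/-! ### The order valuation at the vertex. -/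

section Valuation

open Polynomial

variable {R : Type} [CommRing R] [Algebra ℂ R]
variable (𝒜 : ℕ → Submodule ℂ R) [GradedAlgebra 𝒜]

/-- The coaction, with values in Laurent series over the function field. -/
def laurentHom : R →+* HahnSeries ℤ (FractionRing R) :=
  (HahnSeries.ofPowerSeries ℤ (FractionRing R)).comp
    ((coeToPowerSeries.ringHom (R := FractionRing R)).comp
      ((mapRingHom (algebraMap R (FractionRing R))).comp (coaction 𝒜).toRingHom))

theorem coeff_laurentHom_natCast (f : R) (n : ℕ) :
    (laurentHom 𝒜 f).coeff n = algebraMap R (FractionRing R) (GradedAlgebra.proj 𝒜 n f) := by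
  rw [← coeff_coaction]
  simp [laurentHom, HahnSeries.ofPowerSeries_apply_coeff]

theorem coeff_laurentHom_of_neg (f : R) {n : ℤ} (hn : n < 0) : (laurentHom 𝒜 f).coeff n = 0 := by
  simp only [laurentHom, RingHom.comp_apply]
  rw [HahnSeries.ofPowerSeries_apply]
  refine HahnSeries.embDomain_of_notMem_range ?_
  rintro ⟨m, hm⟩
  simp at hm
  omega

theorem laurentHom_injective : Function.Injective (laurentHom 𝒜) := by
  refine HahnSeries.ofPowerSeries_injective.comp (Polynomial.coe_injective _ |>.comp
    ((map_injective _ (IsFractionRing.injective R (FractionRing R))).comp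
      (coaction_injective 𝒜)))

variable [IsDomain R]

/-- The valuation of the function field given by the order of vanishing with respect to the
grading. -/
def gradVal : AddValuation (FractionRing R) (WithTop ℤ) :=
  (HahnSeries.addVal ℤ (FractionRing R)).comap (IsFractionRing.lift (laurentHom_injective 𝒜))

theorem le_gradVal_algebraMap {f : R} {k : ℤ} :
    (k : WithTop ℤ) ≤ gradVal 𝒜 (algebraMap R (FractionRing R) f) ↔
      ∀ i : ℕ, (i : ℤ) < k → GradedAlgebra.proj 𝒜 i f = 0 := by
  have e : gradVal 𝒜 (algebraMap R (FractionRing R) f) = (laurentHom 𝒜 f).orderTop := by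
    change HahnSeries.addVal ℤ (FractionRing R) (IsFractionRing.lift _ _) = _
    rw [IsFractionRing.lift_algebraMap, HahnSeries.addVal_apply]
  rw [e, HahnSeries.le_orderTop_iff_forall]
  constructor
  · intro h i hi
    have := h i (by exact_mod_cast hi)
    rw [coeff_laurentHom_natCast] at this
    exact (IsFractionRing.injective R (FractionRing R)) (by rw [this, map_zero])
  · intro h j hj
    rcases lt_or_ge j 0 with hj0 | hj0
    · exact coeff_laurentHom_of_neg 𝒜 f hj0
    · lift j to ℕ using hj0
      rw [coeff_laurentHom_natCast, h j (by exact_mod_cast hj), map_zero]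

theorem le_gradVal_of_mem {i : ℕ} {f : R} (hf : f ∈ 𝒜 i) :
    ((i : ℤ) : WithTop ℤ) ≤ gradVal 𝒜 (algebraMap R (FractionRing R) f) :=
  (le_gradVal_algebraMap 𝒜).mpr fun j hj => proj_of_mem_ne 𝒜 hf (by omega)

variable {𝒜} in
theorem gradVal_eq_of_not_le {x : FractionRing R} {k : ℤ} (hx : (k : WithTop ℤ) ≤ gradVal 𝒜 x)
    (hx' : ¬ ((k + 1 : ℤ) : WithTop ℤ) ≤ gradVal 𝒜 x) : gradVal 𝒜 x = k := by
  generalize gradVal 𝒜 x = w at hx hx'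
  induction w using WithTop.recTopCoe with
  | top => exact absurd le_top hx'
  | coe w =>
    rw [WithTop.coe_le_coe] at hx hx'
    rw [WithTop.coe_inj]
    omega

theorem gradVal_of_mem {i : ℕ} {f : R} (hf : f ∈ 𝒜 i) (hf0 : f ≠ 0) :
    gradVal 𝒜 (algebraMap R (FractionRing R) f) = (i : ℤ) :=
  gradVal_eq_of_not_le (le_gradVal_of_mem 𝒜 hf) fun h => hf0 <| by
    rw [← proj_of_mem 𝒜 hf, (le_gradVal_algebraMap 𝒜).mp h i (by omega)]

variable {𝒜} in
theorem le_gradVal_mul {x y : FractionRing R} {k m n : ℤ} (hx : (k : WithTop ℤ) ≤ gradVal 𝒜 x)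
    (hy : (m : WithTop ℤ) ≤ gradVal 𝒜 y) (hn : n ≤ k + m) :
    (n : WithTop ℤ) ≤ gradVal 𝒜 (x * y) := by
  rw [AddValuation.map_mul]
  refine le_trans ?_ (add_le_add hx hy)
  rw [← WithTop.coe_add, WithTop.coe_le_coe]
  exact hn

variable {𝒜} in
theorem le_gradVal_sub {x y : FractionRing R} {k : WithTop ℤ} (hx : k ≤ gradVal 𝒜 x)
    (hy : k ≤ gradVal 𝒜 y) : k ≤ gradVal 𝒜 (x - y) := by
  rw [sub_eq_add_neg]
  exact AddValuation.map_le_add _ hx (by rwa [AddValuation.map_neg])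

-- The form of division used throughout: a bound on x is read off from its product with a
-- denominator of known value.
variable {𝒜} in
theorem le_gradVal_of_mul {x b : FractionRing R} {k m n : ℤ} (hb : gradVal 𝒜 b = m)
    (hx : (k : WithTop ℤ) ≤ gradVal 𝒜 (x * b)) (hn : n + m ≤ k) :
    (n : WithTop ℤ) ≤ gradVal 𝒜 x := by
  rw [AddValuation.map_mul, hb] at hx
  generalize gradVal 𝒜 x = w at hx
  induction w using WithTop.recTopCoe with
  | top => exact le_top
  | coe w =>
    rw [← WithTop.coe_add, WithTop.coe_le_coe] at hx
    rw [WithTop.coe_le_coe]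
    omega

theorem exists_gradVal_eq {b : FractionRing R} (hb : b ≠ 0) : ∃ m : ℤ, gradVal 𝒜 b = m := by
  have := (AddValuation.ne_top_iff (gradVal 𝒜)).mpr hb
  exact ⟨_, (WithTop.coe_untop _ this).symm⟩

theorem gradVal_algebraMap_nonneg (f : R) :
    ((0 : ℤ) : WithTop ℤ) ≤ gradVal 𝒜 (algebraMap R (FractionRing R) f) :=
  (le_gradVal_algebraMap 𝒜).mpr fun i hi => by omega

/-- The valuation ring of `gradVal`. -/
def gradValSubring : ValuationSubring (FractionRing R) where
  carrier := {x | ((0 : ℤ) : WithTop ℤ) ≤ gradVal 𝒜 x}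
  mul_mem' ha hb := le_gradVal_mul ha hb (by simp)
  one_mem' := by
    rw [← map_one (algebraMap R (FractionRing R))]
    exact gradVal_algebraMap_nonneg 𝒜 1
  add_mem' {a b} ha hb := show _ ≤ gradVal 𝒜 (a + b) from AddValuation.map_le_add _ ha hb
  zero_mem' := by simp
  neg_mem' ha := by simpa using ha
  mem_or_inv_mem' x := by
    by_cases hx : x = 0
    · left; simp [hx]
    obtain ⟨m, hm⟩ := exists_gradVal_eq 𝒜 hx
    rcases le_total 0 m with h | h
    · left
      change _ ≤ gradVal 𝒜 x
      rw [hm]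
      exact_mod_cast h
    · right
      refine le_gradVal_of_mul (k := 0) hm ?_ (by omega)
      rw [inv_mul_cancel₀ hx, ← map_one (algebraMap R (FractionRing R))]
      exact gradVal_algebraMap_nonneg 𝒜 1

/-- A homogeneous fraction a/b equals the quotient of one component of a by a nonzero component of
b, and the degrees of these differ by k. -/
theorem HasDegree.le_gradVal {h : FractionRing R} {k : ℤ} (hh : HasDegree 𝒜 h k) :
    (k : WithTop ℤ) ≤ gradVal 𝒜 h := by
  obtain ⟨a, b, hb, rfl⟩ := IsFractionRing.div_surjective (A := R) h
  have hb0 := IsFractionRing.to_map_ne_zero_of_mem_nonZeroDivisors (K := FractionRing R) hb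
  have hab := div_mul_cancel₀ (algebraMap R (FractionRing R) a) hb0
  obtain ⟨j, hj⟩ : ∃ j : ℕ, GradedAlgebra.proj 𝒜 j b ≠ 0 := by
    by_contra! hall
    refine nonZeroDivisors.ne_zero hb (coaction_injective 𝒜 ?_)
    ext j
    rw [coeff_coaction, hall, map_zero, coeff_zero]
  have key := hh.intProj_mul_eq 𝒜 hab j
  rw [intProj_natCast] at key
  have hbj := gradVal_of_mem 𝒜 (proj_mem 𝒜 j b) hj
  refine le_gradVal_of_mul (k := j + k) hbj ?_ (by omega)
  have e : algebraMap R (FractionRing R) a / algebraMap R (FractionRing R) b *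
      algebraMap R (FractionRing R) (GradedAlgebra.proj 𝒜 j b) =
      algebraMap R (FractionRing R) (intProj 𝒜 (j + k) a) := by
    rw [div_mul_eq_mul_div, div_eq_iff hb0, ← map_mul, ← map_mul, key, mul_comm]
  rw [e, intProj]
  split_ifs with h0
  · have := le_gradVal_of_mem 𝒜 (proj_mem 𝒜 (j + k).toNat a)
    rwa [Int.toNat_of_nonneg h0] at this
  · simp

theorem exists_fraction_of_le_gradVal {x : FractionRing R} {k : ℤ}
    (hx : (k : WithTop ℤ) ≤ gradVal 𝒜 x) :
    ∃ (a b : R) (m : ℤ), x * algebraMap R (FractionRing R) b = algebraMap R (FractionRing R) a ∧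
      b ≠ 0 ∧ gradVal 𝒜 (algebraMap R (FractionRing R) b) = m ∧
      ((k + m : ℤ) : WithTop ℤ) ≤ gradVal 𝒜 (algebraMap R (FractionRing R) a) := by
  obtain ⟨a, b, hb, rfl⟩ := IsFractionRing.div_surjective (A := R) x
  have hb0 := IsFractionRing.to_map_ne_zero_of_mem_nonZeroDivisors (K := FractionRing R) hb
  obtain ⟨m, hm⟩ := exists_gradVal_eq 𝒜 hb0
  have hab := div_mul_cancel₀ (algebraMap R (FractionRing R) a) hb0
  refine ⟨a, b, m, hab, nonZeroDivisors.ne_zero hb, hm, ?_⟩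
  rw [← hab]
  exact le_gradVal_mul hx hm.ge le_rfl

theorem derivation_mul_sq (D : VectorField (FractionRing R)) {x a b : FractionRing R}
    (h : x * b = a) : D x * (b * b) = D a * b - a * D b := by
  rw [← h, D.leibniz]
  simp only [smul_eq_mul]
  ring

/-- A vector field that shifts degrees by at least `c` shifts orders of vanishing by at
least `c`. -/
theorem le_gradVal_derivation (D : VectorField (FractionRing R)) {c : ℤ}
    (hD : ∀ (i : ℕ), ∀ f ∈ 𝒜 i,
      ((i + c : ℤ) : WithTop ℤ) ≤ gradVal 𝒜 (D (algebraMap R (FractionRing R) f)))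
    {x : FractionRing R} {k : ℤ} (hx : (k : WithTop ℤ) ≤ gradVal 𝒜 x) :
    ((k + c : ℤ) : WithTop ℤ) ≤ gradVal 𝒜 (D x) := by
  classical
  have hR : ∀ (a : R) (m : ℤ), (m : WithTop ℤ) ≤ gradVal 𝒜 (algebraMap R (FractionRing R) a) →
      ((m + c : ℤ) : WithTop ℤ) ≤ gradVal 𝒜 (D (algebraMap R (FractionRing R) a)) := by
    intro a m ha
    rw [← DirectSum.sum_support_decompose 𝒜 a, map_sum, map_sum]
    refine AddValuation.map_le_sum _ fun i hi => ?_
    refine le_trans ?_ (hD i _ (Subtype.property _))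
    rw [WithTop.coe_le_coe]
    -- Components of a below degree m vanish, so every summand that occurs has degree at least m.
    by_contra! h
    have h0 := (le_gradVal_algebraMap 𝒜).mp ha i (by omega)
    rw [GradedAlgebra.proj_apply] at h0
    exact DFinsupp.mem_support_iff.mp hi (by simpa using h0)
  obtain ⟨a, b, m, hab, -, hm, ha⟩ := exists_fraction_of_le_gradVal 𝒜 hx
  have hbb : gradVal 𝒜 (algebraMap R (FractionRing R) b * algebraMap R (FractionRing R) b) =
      ((m + m : ℤ) : WithTop ℤ) := by
    rw [AddValuation.map_mul, hm, WithTop.coe_add]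
  refine le_gradVal_of_mul (k := k + c + (m + m)) hbb ?_ (by omega)
  rw [derivation_mul_sq D hab]
  exact le_gradVal_sub (le_gradVal_mul (hR a _ ha) hm.ge (by omega))
    (le_gradVal_mul ha (hR b _ hm.ge) (by omega))

/-- The Euler vector field is logarithmic along the divisor of `gradVal`. -/
theorem one_le_gradVal_euler (E : VectorField (FractionRing R))
    (hE : ∀ f : R, E (algebraMap R (FractionRing R) f) =
      algebraMap R (FractionRing R) (eulerDerivation 𝒜 f))
    {x : FractionRing R} (hx : ((0 : ℤ) : WithTop ℤ) ≤ gradVal 𝒜 x) :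
    ((1 : ℤ) : WithTop ℤ) ≤ gradVal 𝒜 (E x) := by
  obtain ⟨a, b, m, hab, -, hm, ha⟩ := exists_fraction_of_le_gradVal 𝒜 hx
  rw [zero_add] at ha
  have hbb : gradVal 𝒜 (algebraMap R (FractionRing R) b * algebraMap R (FractionRing R) b) =
      ((m + m : ℤ) : WithTop ℤ) := by
    rw [AddValuation.map_mul, hm, WithTop.coe_add]
  -- E − m kills the component of degree m. Replacing E by E − m in the numerator E(a) b − a E(b) of
  -- the quotient rule does not change it, and gains one order of vanishing.
  have hshift : ∀ f : R, (m : WithTop ℤ) ≤ gradVal 𝒜 (algebraMap R (FractionRing R) f) →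
      ((m + 1 : ℤ) : WithTop ℤ) ≤
        gradVal 𝒜 (algebraMap R (FractionRing R) (eulerDerivation 𝒜 f - m * f)) := by
    intro f hf
    rw [le_gradVal_algebraMap] at hf ⊢
    intro i hi
    have : GradedAlgebra.proj 𝒜 i ((m : R) * f) = (m : R) * GradedAlgebra.proj 𝒜 i f := by
      rw [← zsmul_eq_mul, ← zsmul_eq_mul, map_zsmul]
    rw [map_sub, proj_eulerDerivation, this, ← sub_mul]
    rcases lt_or_eq_of_le (show (i : ℤ) ≤ m by omega) with h | h
    · rw [hf i h, mul_zero]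
    · rw [← h, Int.cast_natCast, sub_self, zero_mul]
  refine le_gradVal_of_mul (k := m + m + 1) hbb ?_ (by omega)
  have e : E x * (algebraMap R (FractionRing R) b * algebraMap R (FractionRing R) b) =
      algebraMap R (FractionRing R) (eulerDerivation 𝒜 a - m * a) * algebraMap R _ b -
        algebraMap R (FractionRing R) a *
          algebraMap R (FractionRing R) (eulerDerivation 𝒜 b - m * b) := by
    rw [derivation_mul_sq E hab, hE, hE]
    simp only [map_sub, map_mul]
    ring
  rw [e]
  exact le_gradVal_sub (le_gradVal_mul (hshift a ha) hm.ge (by omega))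
    (le_gradVal_mul ha (hshift b hm.ge) (by omega))

end Valuation

/-! ### Symplectic bases. -/

section SymplecticBasis

/-- A nondegenerate alternating form on a finite-dimensional space has a symplectic basis. -/
theorem exists_symplectic_family {F : Type*} [Field F] (n : ℕ) :
    ∀ {W : Type} [AddCommGroup W] [Module F W] [FiniteDimensional F W] (B : W →ₗ[F] W →ₗ[F] F),
      B.IsAlt → (∀ w, (∀ w', B w w' = 0) → w = 0) → Module.finrank F W = n →
      ∃ (d : ℕ) (b : Fin d ⊕ Fin d → W),
        (∀ i j, B (b (.inl i)) (b (.inl j)) = 0) ∧ (∀ i j, B (b (.inr i)) (b (.inr j)) = 0) ∧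
        (∀ i j, B (b (.inl i)) (b (.inr j)) = if i = j then 1 else 0) ∧
        Submodule.span F (Set.range b) = ⊤ := by
  induction n using Nat.strong_induction_on with
  | _ n ih =>
  intro W _ _ _ B hB hnd hn
  by_cases hW : ∀ u : W, u = 0
  · refine ⟨0, fun x => x.elim Fin.elim0 Fin.elim0, nofun, nofun, nofun, ?_⟩
    rw [eq_top_iff]
    intro u _
    rw [hW u]
    exact zero_mem _
  push Not at hW
  obtain ⟨u, hu⟩ := hW
  obtain ⟨v, huv⟩ : ∃ v, B u v = 1 := by
    by_contra! h
    refine hu (hnd u fun w => ?_)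
    by_contra hw
    exact h ((B u w)⁻¹ • w) (by rw [map_smul, smul_eq_mul, inv_mul_cancel₀ hw])
  have hvu : B v u = -1 := by rw [← hB.neg, huv]
  have huu : B u u = 0 := hB u
  have hvv : B v v = 0 := hB v
  -- The orthogonal complement of the hyperbolic plane spanned by u and v. The projection in `hproj`
  -- shows that the form stays nondegenerate on it and that it spans W together with u and v.
  let W' : Submodule F W := LinearMap.ker (B u) ⊓ LinearMap.ker (B v)
  have hW' : ∀ w, w ∈ W' ↔ B u w = 0 ∧ B v w = 0 := fun w => by simp [W']
  have hproj : ∀ z, z - B u z • v + B v z • u ∈ W' := fun z => by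
    rw [hW']
    simp [huv, hvu, huu, hvv]
  have hlt : Module.finrank F W' < n := by
    rw [← hn]
    refine Submodule.finrank_lt fun h => ?_
    have : u ∈ W' := h ▸ Submodule.mem_top
    rw [hW', hvu] at this
    simp at this
  obtain ⟨d, b, h1, h2, h3, h4⟩ := ih _ hlt (B.compl₁₂ W'.subtype W'.subtype) (fun w => hB w)
    (fun w hw => by
      obtain ⟨w, hw'⟩ := w
      have hwu : B w u = 0 := by rw [← hB.neg, ((hW' w).mp hw').1, neg_zero]
      have hwv : B w v = 0 := by rw [← hB.neg, ((hW' w).mp hw').2, neg_zero]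
      refine Subtype.ext (hnd w fun z => ?_)
      have := hw ⟨_, hproj z⟩
      simpa [hwu, hwv] using this) rfl
  simp only [LinearMap.compl₁₂_apply, Submodule.subtype_apply] at h1 h2 h3
  have hbu : ∀ x, B u (b x) = 0 := fun x => ((hW' _).mp (b x).2).1
  have hbv : ∀ x, B v (b x) = 0 := fun x => ((hW' _).mp (b x).2).2
  have hub : ∀ x, B (b x) u = 0 := fun x => by rw [← hB.neg, hbu, neg_zero]
  have hvb : ∀ x, B (b x) v = 0 := fun x => by rw [← hB.neg, hbv, neg_zero]
  refine ⟨d + 1, Sum.elim (Fin.cons u fun i => b (.inl i)) (Fin.cons v fun i => b (.inr i)),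
    fun i j => ?_, fun i j => ?_, fun i j => ?_, ?_⟩
  · refine Fin.cases ?_ (fun i => ?_) i <;> refine Fin.cases ?_ (fun j => ?_) j <;>
      simp [huu, hbu, hub, h1]
  · refine Fin.cases ?_ (fun i => ?_) i <;> refine Fin.cases ?_ (fun j => ?_) j <;>
      simp [hvv, hbv, hvb, h2]
  · refine Fin.cases ?_ (fun i => ?_) i <;> refine Fin.cases ?_ (fun j => ?_) j <;>
      simp [huv, hbu, hvb, h3, Fin.succ_ne_zero, (Fin.succ_ne_zero _).symm]
  · set b' : Fin (d + 1) ⊕ Fin (d + 1) → W :=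
      Sum.elim (Fin.cons u fun i => b (.inl i)) (Fin.cons v fun i => b (.inr i))
    have hu' : u ∈ Submodule.span F (Set.range b') := Submodule.subset_span ⟨.inl 0, rfl⟩
    have hv' : v ∈ Submodule.span F (Set.range b') := Submodule.subset_span ⟨.inr 0, rfl⟩
    have hle : W' ≤ Submodule.span F (Set.range b') := by
      have := congrArg (Submodule.map W'.subtype) h4
      rw [Submodule.map_span, Submodule.map_top, Submodule.range_subtype] at this
      rw [← this, Submodule.span_le]
      rintro _ ⟨_, ⟨x, rfl⟩, rfl⟩
      refine Submodule.subset_span ?_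
      rcases x with i | i
      · exact ⟨.inl i.succ, by simp [b']⟩
      · exact ⟨.inr i.succ, by simp [b']⟩
    rw [eq_top_iff]
    intro z _
    have : z = (z - B u z • v + B v z • u) + B u z • v - B v z • u := by abel
    rw [this]
    exact sub_mem (add_mem (hle (hproj z)) (Submodule.smul_mem _ _ hv'))
      (Submodule.smul_mem _ _ hu')

end SymplecticBasis

/-! ### Hamiltonian vector fields. -/

section Hamiltonian

variable {K : Type} [Field K] [Algebra ℂ K]

/-- `H` sends each function to its Hamiltonian vector field, for a nondegenerate `ω`. -/
structure IsHamiltonian (ω : TwoForm K) (H : K → VectorField K) : Prop where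
  injective : Function.Injective ω
  apply : ∀ f, ω (H f) = dOne f

namespace IsHamiltonian

variable {ω : TwoForm K} {H : K → VectorField K}

theorem apply_apply (hH : IsHamiltonian ω H) (f : K) (D : VectorField K) : ω (H f) D = D f := by
  rw [hH.apply]; rfl

theorem eq_of_apply (hH : IsHamiltonian ω H) {f : K} {D : VectorField K}
    (h : ω D = dOne f) : D = H f :=
  hH.injective (by rw [h, hH.apply])

theorem add (hH : IsHamiltonian ω H) (f g : K) : H (f + g) = H f + H g :=
  (hH.eq_of_apply (by ext D; simp [hH.apply, dOne])).symm

theorem smul (hH : IsHamiltonian ω H) (c : ℂ) (f : K) : H (c • f) = c • H f :=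
  (hH.eq_of_apply (by
    ext D
    rw [← algebraMap_smul K c (H f), map_smul, hH.apply]
    simp [dOne])).symm

theorem swap (hH : IsHamiltonian ω H) (hω : ω.IsAlt) (f g : K) : H f g = - H g f := by
  rw [← hH.apply_apply g (H f), ← hH.apply_apply f (H g), hω.neg]

end IsHamiltonian

end Hamiltonian

/-! ### Regularity and degree of Poisson brackets. -/

section Variety

variable {R : Type} [CommRing R] [IsDomain R]

theorem mem_localRing {p : PrimeSpectrum R} {x : FractionRing R} :
    x ∈ localRing R p ↔ ∃ a s : R, s ∉ p.asIdeal ∧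
      x * algebraMap R (FractionRing R) s = algebraMap R (FractionRing R) a := by
  change (∃ (a s : R) (_ : s ∈ p.asIdeal.primeCompl), x = _ * _) ↔ _
  refine exists_congr fun a => exists_congr fun s => ?_
  rw [exists_prop]
  refine and_congr_right fun hs => ?_
  have hs0 : algebraMap R (FractionRing R) s ≠ 0 :=
    IsFractionRing.to_map_ne_zero_of_mem_nonZeroDivisors
      (p.asIdeal.primeCompl_le_nonZeroDivisors hs)
  rw [← div_eq_mul_inv, eq_div_iff hs0]

theorem algebraMap_mem_localRing (p : PrimeSpectrum R) (a : R) :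
    algebraMap R (FractionRing R) a ∈ localRing R p :=
  mem_localRing.mpr ⟨a, 1, p.asIdeal.one_notMem, by simp⟩

theorem mem_localRing_bot (x : FractionRing R) : x ∈ localRing R ⊥ := by
  obtain ⟨a, b, hb, rfl⟩ := IsFractionRing.div_surjective (A := R) x
  have hb0 := IsFractionRing.to_map_ne_zero_of_mem_nonZeroDivisors (K := FractionRing R) hb
  exact mem_localRing.mpr ⟨a, b, by simpa using nonZeroDivisors.ne_zero hb,
    div_mul_cancel₀ _ hb0⟩

variable [Algebra ℂ R] {ω : TwoForm (FractionRing R)}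

/-- At the generic point the local ring is the whole function field, so every rational field is
regular there and nondegeneracy provides H_f. -/
theorem IsSymplecticForm.exists_hamiltonian [Algebra.FiniteType ℂ R] (hω : IsSymplecticForm R ω) :
    ∃ H, IsHamiltonian ω H := by
  obtain ⟨-, hinj, hsurj⟩ := hω.nondegenerate ⊥ bot_mem_smoothLocus
  have hreg : ∀ D, D ∈ regularVectorFields (localRing R ⊥) := fun D a _ => mem_localRing_bot _
  have h : ∀ f, ∃ D, ω D = dOne f := fun f => by
    obtain ⟨D, -, hD⟩ := hsurj (Submodule.subset_span ⟨f, mem_localRing_bot f, rfl⟩)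
    exact ⟨D, hD⟩
  choose H hH using h
  exact ⟨H, fun D D' h => hinj (hreg D) (hreg D') h, hH⟩

/-- Nondegeneracy at p gives a regular field dual to df; by uniqueness it is H_f. -/
theorem IsHamiltonian.mem_localRing (hω : IsSymplecticForm R ω)
    {H : FractionRing R → VectorField (FractionRing R)} (hH : IsHamiltonian ω H)
    {p : PrimeSpectrum R} (hp : p ∈ smoothPart R) {f g : FractionRing R}
    (hf : f ∈ localRing R p) (hg : g ∈ localRing R p) : H f g ∈ localRing R p := by
  obtain ⟨-, -, hsurj⟩ := hω.nondegenerate p hp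
  obtain ⟨D, hD, e⟩ := hsurj (Submodule.subset_span ⟨f, hf, rfl⟩)
  rw [← hH.eq_of_apply e]
  exact hD g hg

/-- The Poisson bracket of functions on a normal variety is a function. -/
theorem IsHamiltonian.exists_algebraMap_eq [Algebra.FiniteType ℂ R] [IsIntegrallyClosed R]
    (hω : IsSymplecticForm R ω)
    {H : FractionRing R → VectorField (FractionRing R)} (hH : IsHamiltonian ω H) (f g : R) :
    ∃ r : R, algebraMap R (FractionRing R) r =
      H (algebraMap R (FractionRing R) f) (algebraMap R (FractionRing R) g) := by
  have : IsNoetherianRing R := Algebra.FiniteType.isNoetherianRing ℂ R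
  refine exists_algebraMap_eq_of_forall_isPrincipal _ fun p hp hprin => ?_
  exact ConicalSymplectic.mem_localRing.mp (hH.mem_localRing hω (p := ⟨p, hp⟩)
    (isSmoothAt_of_isPrincipal p hprin) (algebraMap_mem_localRing _ f)
    (algebraMap_mem_localRing _ g))

variable (𝒜 : ℕ → Submodule ℂ R) [GradedAlgebra 𝒜]

/-- The action of t scales ω by t^l and df by t^k, so it conjugates H_f into t^(k-l) H_f. -/
theorem IsHamiltonian.hasDegree {l : ℤ} (hl : HasWeight 𝒜 ω l)
    {H : FractionRing R → VectorField (FractionRing R)} (hH : IsHamiltonian ω H)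
    {f g : FractionRing R} {k j : ℤ} (hf : HasDegree 𝒜 f k) (hg : HasDegree 𝒜 g j) :
    HasDegree 𝒜 (H f g) (k + j - l) := fun t => by
  let σ := fieldAction 𝒜 t
  have ht : (t : ℂ) ≠ 0 := t.ne_zero
  let D' := conjVectorField σ.symm (H f)
  have hD' : conjVectorField σ D' = H f := by
    ext a
    simp [D', conjVectorField_apply]
  have hωD' : ω D' = algebraMap ℂ (FractionRing R) ((t : ℂ) ^ (k - l)) • ω (H f) := by
    ext D
    have h1 : σ (ω (conjVectorField σ D') (conjVectorField σ D)) =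
        algebraMap ℂ (FractionRing R) ((t : ℂ) ^ l) * ω D' D :=
      congrArg (fun η : TwoForm (FractionRing R) => η D' D) (hl t)
    rw [hD', hH.apply_apply, conjVectorField_apply, AlgEquiv.apply_symm_apply] at h1
    have h2 : D (σ f) = algebraMap ℂ (FractionRing R) ((t : ℂ) ^ k) * D f := by
      rw [show σ f = _ from hf t, ← Algebra.smul_def, D.map_smul, Algebra.smul_def]
    rw [h2] at h1
    rw [LinearMap.smul_apply, hH.apply_apply, smul_eq_mul, zpow_sub₀ ht, map_div₀,
      div_mul_eq_mul_div, h1, mul_div_cancel_left₀]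
    exact (map_ne_zero _).mpr (zpow_ne_zero _ ht)
  rw [← map_smul] at hωD'
  have h3 := congrArg (fun D : VectorField (FractionRing R) => D (σ g)) (hH.injective hωD')
  have h4 : D' (σ g) = σ (H f g) := by simp [D', conjVectorField_apply]
  simp only [h4] at h3
  have h5 : H f (σ g) = algebraMap ℂ (FractionRing R) ((t : ℂ) ^ j) * H f g := by
    rw [show σ g = _ from hg t, ← Algebra.smul_def, (H f).map_smul, Algebra.smul_def]
  rw [show fieldAction 𝒜 t (H f g) = _ from h3, Derivation.smul_apply, h5, smul_eq_mul,
    ← mul_assoc, ← map_mul, ← zpow_add₀ ht]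
  congr 3
  ring

end Variety

/-! ### The bounds 1 ≤ l ≤ 2. -/

section Weight

variable {R : Type} [CommRing R] [Algebra ℂ R] (𝒜 : ℕ → Submodule ℂ R)

/-- Maximal weight one: the ring is generated by finitely many elements of degree one, not all of
them zero. -/
theorem HasMaximalWeight.exists_finite_degree_one (h0 : 𝒜 0 = 1) (hN : HasMaximalWeight 𝒜 1) :
    ∃ s : Set R, s.Finite ∧ (∀ f ∈ s, f ∈ 𝒜 1) ∧ Algebra.adjoin ℂ s = ⊤ ∧ ∃ f ∈ s, f ≠ 0 := by
  obtain ⟨n, x, a, hxa, hgen, hmin, hsup⟩ := hN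
  refine ⟨x '' {i | a i = 1}, (Set.toFinite _).image _, ?_, ?_, ?_⟩
  · rintro _ ⟨i, hi, rfl⟩
    exact (show a i = 1 from hi) ▸ hxa i
  · rw [eq_top_iff, ← hgen]
    refine Algebra.adjoin_le ?_
    rintro _ ⟨i, rfl⟩
    have hi : a i ≤ 1 := hsup ▸ Finset.le_sup (Finset.mem_univ i)
    rcases Nat.le_one_iff_eq_zero_or_eq_one.mp hi with hi | hi
    · have := hxa i
      rw [hi, h0, Submodule.mem_one] at this
      obtain ⟨c, hc⟩ := this
      rw [← hc]
      exact Subalgebra.algebraMap_mem _ c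
    · exact Algebra.subset_adjoin ⟨i, hi, rfl⟩
  · obtain ⟨i, -, hi⟩ := Finset.exists_mem_eq_sup Finset.univ Finset.univ_nonempty a
    -- A zero generator would lie in the subalgebra generated by the others, against minimality.
    refine ⟨x i, ⟨i, hi.symm.trans hsup, rfl⟩, fun h => hmin i ?_⟩
    rw [h]
    exact zero_mem _

variable [GradedAlgebra 𝒜]

theorem eulerDerivation_of_mem_one {f : R} (hf : f ∈ 𝒜 1) : eulerDerivation 𝒜 f = f := by
  rw [eulerDerivation_of_mem 𝒜 hf, Nat.cast_one, one_mul]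

variable [IsDomain R]

theorem derivation_eq_of_eqOn_generators {s : Set R} (hs : Algebra.adjoin ℂ s = ⊤)
    {D D' : VectorField (FractionRing R)}
    (h : ∀ g ∈ s, D (algebraMap R (FractionRing R) g) = D' (algebraMap R (FractionRing R) g)) :
    D = D' := by
  refine derivation_eq_of_eqOn_algebraMap R fun b => ?_
  have hb : b ∈ Algebra.adjoin ℂ s := hs ▸ Algebra.mem_top
  have := Derivation.eqOn_adjoin (D1 := D.compAlgebraMap R) (D2 := D'.compAlgebraMap R)
    (s := s) h hb
  exact this

theorem exists_euler : ∃ E : VectorField (FractionRing R), ∀ f : R,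
    E (algebraMap R (FractionRing R) f) =
      algebraMap R (FractionRing R) (eulerDerivation 𝒜 f) :=
  exists_derivation_extending ((Algebra.linearMap R (FractionRing R)).compDer (eulerDerivation 𝒜))

/-- A function of degree one that commutes with all generators vanishes. -/
theorem IsHamiltonian.eq_zero_of_forall_apply_eq_zero {ω : TwoForm (FractionRing R)}
    {H : FractionRing R → VectorField (FractionRing R)} (hH : IsHamiltonian ω H) {s : Set R}
    (hs : Algebra.adjoin ℂ s = ⊤) {f : R} (hf : f ∈ 𝒜 1)
    (h : ∀ g ∈ s, H (algebraMap R (FractionRing R) f) (algebraMap R (FractionRing R) g) = 0) :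
    f = 0 := by
  obtain ⟨E, hE⟩ := exists_euler 𝒜
  have hHf : H (algebraMap R (FractionRing R) f) = 0 :=
    derivation_eq_of_eqOn_generators hs fun g hg => by rw [h g hg, Derivation.zero_apply]
  have := hH.apply_apply (algebraMap R (FractionRing R) f) E
  rw [hHf, map_zero, LinearMap.zero_apply, hE, eulerDerivation_of_mem_one 𝒜 hf] at this
  exact IsFractionRing.injective R (FractionRing R) (by rw [← this, map_zero])

/-- A form that is regular along a subring of the valuation ring vanishes, to first order, on a
pair of regular vector fields one of which is logarithmic. -/
theorem one_le_gradVal_of_mem_regularTwoForms {A : Subring (FractionRing R)}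
    (hA : A ≤ (gradValSubring 𝒜).toSubring) {ω : TwoForm (FractionRing R)}
    (hω : ω ∈ regularTwoForms A) {E D : VectorField (FractionRing R)}
    (hE : ∀ x : FractionRing R, ((0 : ℤ) : WithTop ℤ) ≤ gradVal 𝒜 x →
      ((1 : ℤ) : WithTop ℤ) ≤ gradVal 𝒜 (E x))
    (hD : ∀ x : FractionRing R, ((0 : ℤ) : WithTop ℤ) ≤ gradVal 𝒜 x →
      ((0 : ℤ) : WithTop ℤ) ≤ gradVal 𝒜 (D x)) :
    ((1 : ℤ) : WithTop ℤ) ≤ gradVal 𝒜 (ω E D) := by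
  induction hω using Submodule.span_induction with
  | mem η hη =>
    obtain ⟨a, ha, b, hb, rfl⟩ := hη
    change _ ≤ gradVal 𝒜 (E a * D b - E b * D a)
    exact le_gradVal_sub (le_gradVal_mul (hE a (hA ha)) (hD b (hA hb)) (by simp))
      (le_gradVal_mul (hE b (hA hb)) (hD a (hA ha)) (by simp))
  | zero => simp
  | add x y _ _ hx hy => exact AddValuation.map_le_add _ hx hy
  | smul c x _ hx => exact le_gradVal_mul (x := (c : FractionRing R)) (hA c.2) hx (by simp)

theorem HasDegree.zpow {f : FractionRing R} {k : ℤ} (hf : HasDegree 𝒜 f k) (n : ℤ) :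
    HasDegree 𝒜 (f ^ n) (k * n) := fun t => by
  rw [map_zpow₀, hf t, mul_zpow, ← map_zpow₀, ← zpow_mul]

variable {𝒜} {ω : TwoForm (FractionRing R)}

theorem one_le_weight {l : ℤ} (hX : IsConicalSymplecticVariety 𝒜 ω)
    (hN : HasMaximalWeight 𝒜 1) (hl : HasWeight 𝒜 ω l) : 1 ≤ l := by
  have := hX.finiteType
  obtain ⟨ρ, hρ⟩ := hX.extends_resolution
  obtain ⟨y, hy⟩ := ρ.exists_localRing_le (gradValSubring 𝒜) (gradVal_algebraMap_nonneg 𝒜)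
  obtain ⟨H, hH⟩ := hX.symplectic.exists_hamiltonian
  obtain ⟨E, hE⟩ := exists_euler 𝒜
  obtain ⟨s, -, hs1, -, f, hfs, hf0⟩ := hN.exists_finite_degree_one 𝒜 hX.degree_zero
  have hf1 := hs1 f hfs
  have hF1 := hasDegree_of_mem 𝒜 hf1
  have hF0 : algebraMap R (FractionRing R) f ≠ 0 :=
    (map_ne_zero_iff _ (IsFractionRing.injective R (FractionRing R))).mpr hf0
  have hEF : E (algebraMap R (FractionRing R) f) = algebraMap R (FractionRing R) f := by
    rw [hE, eulerDerivation_of_mem_one 𝒜 hf1]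
  generalize algebraMap R (FractionRing R) f = F at *
  rw [Nat.cast_one] at hF1
  have hpow : ∀ n : ℤ, (n : WithTop ℤ) ≤ gradVal 𝒜 (F ^ n) := fun n => by
    simpa using (hF1.zpow 𝒜 n).le_gradVal 𝒜
  have hHF : ∀ x : FractionRing R, ((0 : ℤ) : WithTop ℤ) ≤ gradVal 𝒜 x →
      ((1 - l : ℤ) : WithTop ℤ) ≤ gradVal 𝒜 (H F x) := fun x hx => by
    have := le_gradVal_derivation 𝒜 (H F) (c := 1 - l) (fun i g hg => by
      have := (hH.hasDegree 𝒜 hl hF1 (hasDegree_of_mem 𝒜 hg)).le_gradVal 𝒜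
      rwa [show (1 : ℤ) + i - l = i + (1 - l) by ring] at this) hx
    rwa [zero_add] at this
  -- The factor F^(l-1) compensates the shift 1 − l of H_F; the pairing with E is then -F^l.
  have key := one_le_gradVal_of_mem_regularTwoForms 𝒜 hy (hρ y) (E := E)
    (D := F ^ (l - 1) • H F) (fun x hx => one_le_gradVal_euler 𝒜 E hE hx)
    (fun x hx => le_gradVal_mul (hpow (l - 1)) (hHF x hx) (by omega))
  rw [map_smul, ← hX.symplectic.alternating.neg, hH.apply_apply, hEF, smul_eq_mul, mul_neg,
    AddValuation.map_neg, ← zpow_add_one₀ hF0, sub_add_cancel] at key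
  by_contra! hlt
  -- If l ≤ 0, multiplying F^l by F^(-l) would give v(1) ≥ 1.
  have := le_gradVal_mul (n := 1) key (hpow (-l)) (by omega)
  rw [← zpow_add₀ hF0, add_neg_cancel, zpow_zero, AddValuation.map_one] at this
  exact absurd (WithTop.coe_le_coe.mp this) (by norm_num)

theorem exists_hasDegree_eq_bracket [IsIntegrallyClosed R] [Algebra.FiniteType ℂ R] {l : ℤ}
    (hω : IsSymplecticForm R ω) (hl : HasWeight 𝒜 ω l)
    {H : FractionRing R → VectorField (FractionRing R)} (hH : IsHamiltonian ω H)
    {f g : R} (hf : f ∈ 𝒜 1) (hg : g ∈ 𝒜 1) :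
    ∃ r : R, algebraMap R (FractionRing R) r =
        H (algebraMap R (FractionRing R) f) (algebraMap R (FractionRing R) g) ∧
      HasDegree 𝒜 (algebraMap R (FractionRing R) r) (2 - l) := by
  obtain ⟨r, hr⟩ := hH.exists_algebraMap_eq hω f g
  refine ⟨r, hr, ?_⟩
  rw [hr]
  exact hH.hasDegree 𝒜 hl (hasDegree_of_mem 𝒜 hf) (hasDegree_of_mem 𝒜 hg)

theorem weight_le_two {l : ℤ} (hX : IsConicalSymplecticVariety 𝒜 ω)
    (hN : HasMaximalWeight 𝒜 1) (hl : HasWeight 𝒜 ω l) : l ≤ 2 := by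
  have := hX.finiteType
  have := hX.normal
  obtain ⟨H, hH⟩ := hX.symplectic.exists_hamiltonian
  obtain ⟨s, -, hs1, hs, f, hfs, hf0⟩ := hN.exists_finite_degree_one 𝒜 hX.degree_zero
  by_contra! h2
  refine hf0 (hH.eq_zero_of_forall_apply_eq_zero 𝒜 hs (hs1 f hfs) fun g hg => ?_)
  obtain ⟨r, hr, hdeg⟩ := exists_hasDegree_eq_bracket hX.symplectic hl hH (hs1 f hfs) (hs1 g hg)
  rw [← hr, hdeg.eq_zero_of_algebraMap 𝒜 (by omega), map_zero]

end Weight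

/-! ### Singularity of the vertex in weight one. -/

section Origin

variable {R : Type} [CommRing R] [Algebra ℂ R] (𝒜 : ℕ → Submodule ℂ R) [GradedAlgebra 𝒜]
variable [IsDomain R]

/-- The vertex of the cone. -/
def vertex : PrimeSpectrum R :=
  ⟨RingHom.ker (Polynomial.constantCoeff.comp (coaction 𝒜).toRingHom), RingHom.ker_isPrime _⟩

theorem gradVal_of_notMem_vertex {s : R} (hs : s ∉ (vertex 𝒜).asIdeal) :
    gradVal 𝒜 (algebraMap R (FractionRing R) s) = (0 : ℤ) := by
  refine gradVal_eq_of_not_le (gradVal_algebraMap_nonneg 𝒜 s) fun h => hs ?_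
  rw [le_gradVal_algebraMap] at h
  refine (RingHom.mem_ker).mpr ?_
  change (coaction 𝒜 s).coeff 0 = 0
  rw [coeff_coaction]
  exact h 0 (by norm_num)

theorem gradVal_nonneg_of_mem_localRing {x : FractionRing R} (hx : x ∈ localRing R (vertex 𝒜)) :
    ((0 : ℤ) : WithTop ℤ) ≤ gradVal 𝒜 x := by
  obtain ⟨a, s, hs, e⟩ := mem_localRing.mp hx
  exact le_gradVal_of_mul (gradVal_of_notMem_vertex 𝒜 hs)
    (e ▸ gradVal_algebraMap_nonneg 𝒜 a) (by omega)

/-- Vanishing of a vector field at the vertex is checked on generators. -/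
theorem one_le_gradVal_derivation_of_generators {s : Set R} (hs : Algebra.adjoin ℂ s = ⊤)
    (D : VectorField (FractionRing R))
    (hD : ∀ f ∈ s, ((1 : ℤ) : WithTop ℤ) ≤ gradVal 𝒜 (D (algebraMap R (FractionRing R) f)))
    {x : FractionRing R} (hx : x ∈ localRing R (vertex 𝒜)) :
    ((1 : ℤ) : WithTop ℤ) ≤ gradVal 𝒜 (D x) := by
  have hR : ∀ a : R, ((1 : ℤ) : WithTop ℤ) ≤ gradVal 𝒜 (D (algebraMap R (FractionRing R) a)) := by
    intro a
    have ha : a ∈ Algebra.adjoin ℂ s := hs ▸ Algebra.mem_top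
    induction ha using Algebra.adjoin_induction with
    | mem f hf => exact hD f hf
    | algebraMap c => simp [← IsScalarTower.algebraMap_apply]
    | add f g _ _ hf hg =>
      rw [map_add, map_add]
      exact AddValuation.map_le_add _ hf hg
    | mul f g _ _ hf hg =>
      rw [map_mul, D.leibniz]
      exact AddValuation.map_le_add _
        (le_gradVal_mul (gradVal_algebraMap_nonneg 𝒜 f) hg (by simp))
        (le_gradVal_mul (gradVal_algebraMap_nonneg 𝒜 g) hf (by simp))
  obtain ⟨a, b, hb, e⟩ := mem_localRing.mp hx
  have hb0 := gradVal_of_notMem_vertex 𝒜 hb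
  have hbb : gradVal 𝒜 (algebraMap R (FractionRing R) b * algebraMap R (FractionRing R) b) =
      (0 : ℤ) := by
    rw [AddValuation.map_mul, hb0, ← WithTop.coe_add, add_zero]
  refine le_gradVal_of_mul (k := 1) hbb ?_ (by omega)
  rw [derivation_mul_sq D e]
  exact le_gradVal_sub (le_gradVal_mul (hR a) (gradVal_algebraMap_nonneg 𝒜 b) (by simp))
    (le_gradVal_mul (gradVal_algebraMap_nonneg 𝒜 a) (hR b) (by simp))

open KaehlerDifferential in
/-- At a smooth vertex some regular vector field does not vanish. -/
theorem exists_regularVectorField_of_vertex_mem_smoothPart (h : vertex 𝒜 ∈ smoothPart R) {f : R}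
    (hf : f ∈ 𝒜 1) (hf0 : f ≠ 0) :
    ∃ D ∈ regularVectorFields (localRing R (vertex 𝒜)),
      ¬ ((1 : ℤ) : WithTop ℤ) ≤ gradVal 𝒜 (D (algebraMap R (FractionRing R) f)) := by
  by_contra! hall
  let p := (vertex 𝒜).asIdeal
  let A := Localization.subalgebra.ofField (FractionRing R) p.primeCompl
    p.primeCompl_le_nonZeroDivisors
  have hsmooth : Algebra.FormallySmooth ℂ (Localization.AtPrime p) := h
  have hA : Algebra.FormallySmooth ℂ A := .of_equiv
    ((IsLocalization.algEquiv p.primeCompl (Localization.AtPrime p) A).restrictScalars ℂ)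
  have hproj : Module.Projective A Ω[A⁄ℂ] := inferInstance
  -- By smoothness the differentials are projective, so they embed as a summand of the free module
  -- on their own elements. Each coordinate of σ composed with d is a regular vector field.
  obtain ⟨σ, hσ⟩ := Module.projective_def'.mp hproj
  obtain ⟨E, hE⟩ := exists_euler 𝒜
  let x : A := algebraMap R A f
  -- Contraction with E. Expanding df in the coordinates of σ, each term of Λ(df) = f is a product
  -- of two factors with v ≥ 1, so v(f) ≥ 2, while f has degree one.
  let Λ : Ω[A⁄ℂ] →ₗ[A] FractionRing R := (E.compAlgebraMap A).liftKaehlerDifferential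
  have hΛ : ∀ η, ((1 : ℤ) : WithTop ℤ) ≤ gradVal 𝒜 (Λ η) := by
    intro η
    have hη : η ∈ Submodule.span A (Set.range (D ℂ A)) := by
      rw [span_range_derivation]; trivial
    induction hη using Submodule.span_induction with
    | mem η hη =>
      obtain ⟨a, rfl⟩ := hη
      rw [Derivation.liftKaehlerDifferential_comp_D]
      exact one_le_gradVal_euler 𝒜 E hE (gradVal_nonneg_of_mem_localRing 𝒜 a.2)
    | zero => simp
    | add η η' _ _ hη hη' => rw [map_add]; exact AddValuation.map_le_add _ hη hη'
    | smul c η _ hη =>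
      rw [map_smul]
      exact le_gradVal_mul (x := (c : FractionRing R)) (gradVal_nonneg_of_mem_localRing 𝒜 c.2) hη
        (by simp)
  have hcoef : ∀ e : Ω[A⁄ℂ],
      ((1 : ℤ) : WithTop ℤ) ≤ gradVal 𝒜 ((σ (D ℂ A x) e : A) : FractionRing R) := by
    intro e
    let δ : Derivation ℂ A A := ((Finsupp.lapply e).comp σ).compDer (D ℂ A)
    obtain ⟨δ', hδ'⟩ := exists_derivation_extending
      ((Algebra.linearMap A (FractionRing R)).compDer δ)
    have := hall δ' fun a ha => by
      have e1 : δ' a = (δ ⟨a, ha⟩ : A) := hδ' ⟨a, ha⟩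
      rw [e1]
      exact (δ ⟨a, ha⟩).2
    have e2 : δ' (algebraMap R (FractionRing R) f) = (δ x : A) := hδ' x
    rwa [e2] at this
  have hdx : Λ (D ℂ A x) = (σ (D ℂ A x)).sum fun e c => (c : FractionRing R) * Λ e := by
    conv_lhs => rw [← LinearMap.id_apply (R := A) (D ℂ A x), ← hσ]
    rw [LinearMap.comp_apply, Finsupp.linearCombination_apply, map_finsuppSum]
    refine Finsupp.sum_congr fun e _ => ?_
    rw [map_smul]
    rfl
  have h2 : ((2 : ℤ) : WithTop ℤ) ≤ gradVal 𝒜 (Λ (D ℂ A x)) := by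
    rw [hdx]
    exact AddValuation.map_le_sum _ fun e _ => le_gradVal_mul (hcoef e) (hΛ e) (by norm_num)
  have e3 : Λ (D ℂ A x) = algebraMap R (FractionRing R) f := by
    rw [Derivation.liftKaehlerDifferential_comp_D]
    exact (hE f).trans (by rw [eulerDerivation_of_mem_one 𝒜 hf])
  rw [e3, gradVal_of_mem 𝒜 hf hf0, WithTop.coe_le_coe] at h2
  norm_num at h2

variable {𝒜} {ω : TwoForm (FractionRing R)}

/-- The Poisson structure of a form of weight one vanishes at the vertex. -/
theorem one_le_gradVal_of_mem_regularVectorFields (hω : IsSymplecticForm R ω)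
    {s : Set R} (hs1 : ∀ f ∈ s, f ∈ 𝒜 1) (hs : Algebra.adjoin ℂ s = ⊤) (hl : HasWeight 𝒜 ω 1)
    {H : FractionRing R → VectorField (FractionRing R)} (hH : IsHamiltonian ω H)
    (hv : vertex 𝒜 ∈ smoothPart R) {D : VectorField (FractionRing R)}
    (hD : D ∈ regularVectorFields (localRing R (vertex 𝒜)))
    {x : FractionRing R} (hx : x ∈ localRing R (vertex 𝒜)) :
    ((1 : ℤ) : WithTop ℤ) ≤ gradVal 𝒜 (D x) := by
  have hHs : ∀ f ∈ s, ∀ a ∈ localRing R (vertex 𝒜),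
      ((1 : ℤ) : WithTop ℤ) ≤ gradVal 𝒜 (H (algebraMap R (FractionRing R) f) a) :=
    fun f hf a ha => one_le_gradVal_derivation_of_generators 𝒜 hs _ (fun g hg =>
      (hH.hasDegree 𝒜 hl (hasDegree_of_mem 𝒜 (hs1 f hf))
        (hasDegree_of_mem 𝒜 (hs1 g hg))).le_gradVal 𝒜) ha
  -- The bound on H_a b is reduced to generators in one slot at a time, with antisymmetry exchanging
  -- the slots. Brackets of generators have degree 1 + 1 − 1 = 1.
  have hHA : ∀ a ∈ localRing R (vertex 𝒜), ∀ b ∈ localRing R (vertex 𝒜),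
      ((1 : ℤ) : WithTop ℤ) ≤ gradVal 𝒜 (H a b) := fun a ha b hb =>
    one_le_gradVal_derivation_of_generators 𝒜 hs _ (fun g hg => by
      rw [hH.swap hω.alternating, AddValuation.map_neg]
      exact hHs g hg a ha) hb
  have hforms : ∀ α ∈ regularOneForms (localRing R (vertex 𝒜)),
      ∃ D', ω D' = α ∧ ∀ b ∈ localRing R (vertex 𝒜),
        ((1 : ℤ) : WithTop ℤ) ≤ gradVal 𝒜 (D' b) := by
    intro α hα
    induction hα using Submodule.span_induction with
    | mem α hα =>
      obtain ⟨a, ha, rfl⟩ := hα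
      exact ⟨H a, hH.apply a, hHA a ha⟩
    | zero => exact ⟨0, map_zero _, fun b _ => by simp⟩
    | add α β _ _ hα hβ =>
      obtain ⟨D₁, h₁, h₁'⟩ := hα
      obtain ⟨D₂, h₂, h₂'⟩ := hβ
      exact ⟨D₁ + D₂, by rw [map_add, h₁, h₂],
        fun b hb => AddValuation.map_le_add _ (h₁' b hb) (h₂' b hb)⟩
    | smul c α _ hα =>
      obtain ⟨D₁, h₁, h₁'⟩ := hα
      exact ⟨(c : FractionRing R) • D₁, by rw [map_smul, h₁]; rfl,
        fun b hb => le_gradVal_mul (gradVal_nonneg_of_mem_localRing 𝒜 c.2) (h₁' b hb) (by simp)⟩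
  obtain ⟨D', hD', hval⟩ := hforms _ ((hω.nondegenerate _ hv).mapsTo hD)
  rw [← hH.injective hD']
  exact hval x hx

theorem isSingular_of_weight_one (hX : IsConicalSymplecticVariety 𝒜 ω)
    (hN : HasMaximalWeight 𝒜 1) (hl : HasWeight 𝒜 ω 1) : IsSingular R := fun hns => by
  have := hX.finiteType
  obtain ⟨H, hH⟩ := hX.symplectic.exists_hamiltonian
  obtain ⟨s, -, hs1, hs, f, hfs, hf0⟩ := hN.exists_finite_degree_one 𝒜 hX.degree_zero
  have hv : vertex 𝒜 ∈ smoothPart R := hns ▸ Set.mem_univ _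
  obtain ⟨D, hD, hDf⟩ := exists_regularVectorField_of_vertex_mem_smoothPart 𝒜 hv (hs1 f hfs) hf0
  exact hDf (one_le_gradVal_of_mem_regularVectorFields hX.symplectic hs1 hs hl hH hv hD
    (algebraMap_mem_localRing _ f))

end Origin

/-! ### Algebraic independence of elements of degree one. -/

section Polynomial

open MvPolynomial

variable {R : Type} [CommRing R] [Algebra ℂ R] (𝒜 : ℕ → Submodule ℂ R) [GradedAlgebra 𝒜]
variable {ι : Type} {y : ι → R}

theorem aeval_mem_of_isHomogeneous (hy : ∀ i, y i ∈ 𝒜 1) {p : MvPolynomial ι ℂ} {n : ℕ}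
    (hp : p.IsHomogeneous n) : aeval y p ∈ 𝒜 n := by
  rw [p.as_sum, map_sum]
  refine Submodule.sum_mem _ fun m hm => ?_
  rw [aeval_monomial, ← Algebra.smul_def]
  refine Submodule.smul_mem _ _ ?_
  have hdeg : m.degree = n := by
    have := hp (mem_support_iff.mp hm)
    rwa [Finsupp.degree_eq_weight_one]
  rw [← hdeg, Finsupp.prod, Finsupp.degree]
  refine SetLike.prod_mem_graded _ _ _ fun i _ => ?_
  have := SetLike.pow_mem_graded (m i) (hy i)
  rwa [smul_eq_mul, mul_one] at this

theorem proj_aeval (hy : ∀ i, y i ∈ 𝒜 1) (p : MvPolynomial ι ℂ) (n : ℕ) :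
    GradedAlgebra.proj 𝒜 n (aeval y p) = aeval y (homogeneousComponent n p) := by
  conv_lhs => rw [← sum_homogeneousComponent p]
  rw [map_sum, map_sum]
  have h : ∀ j, GradedAlgebra.proj 𝒜 n (aeval y (homogeneousComponent j p)) =
      if n = j then aeval y (homogeneousComponent n p) else 0 := fun j => by
    have hj := aeval_mem_of_isHomogeneous 𝒜 hy (homogeneousComponent_isHomogeneous j p)
    split_ifs with h
    · subst h
      exact proj_of_mem 𝒜 hj
    · exact proj_of_mem_ne 𝒜 hj (Ne.symm h)
  rw [Finset.sum_congr rfl fun j _ => h j, Finset.sum_ite_eq]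
  split_ifs with hn
  · rfl
  · rw [homogeneousComponent_eq_zero n p (by simpa using hn), map_zero]

theorem aeval_mem_iff_isHomogeneous (hy : ∀ i, y i ∈ 𝒜 1)
    (hinj : Function.Injective (aeval y : MvPolynomial ι ℂ →ₐ[ℂ] R)) {p : MvPolynomial ι ℂ}
    {n : ℕ} : aeval y p ∈ 𝒜 n ↔ p.IsHomogeneous n := by
  refine ⟨fun h => ?_, aeval_mem_of_isHomogeneous 𝒜 hy⟩
  have := proj_aeval 𝒜 hy p n
  rw [proj_of_mem 𝒜 h] at this
  rw [hinj this]
  exact homogeneousComponent_isHomogeneous n p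

/-- Elements of degree one with a dual family of vector fields are algebraically independent. -/
theorem aeval_injective_of_dual_derivations [IsDomain R] [Fintype ι] [DecidableEq ι]
    (hy : ∀ i, y i ∈ 𝒜 1) (D : ι → VectorField (FractionRing R))
    (hD : ∀ i j, D i (algebraMap R (FractionRing R) (y j)) = if i = j then 1 else 0) :
    Function.Injective (aeval y : MvPolynomial ι ℂ →ₐ[ℂ] R) := by
  have hinjK := IsFractionRing.injective R (FractionRing R)
  have hpderiv : ∀ (i : ι) (p : MvPolynomial ι ℂ), D i (algebraMap R (FractionRing R) (aeval y p)) =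
      algebraMap R (FractionRing R) (aeval y (pderiv i p)) := fun i p => by
    induction p using MvPolynomial.induction_on with
    | C c => simp [← IsScalarTower.algebraMap_apply, algHom_C]
    | add p q hp hq => simp only [map_add, hp, hq]
    | mul_X p j hp =>
      rw [map_mul, map_mul, Derivation.leibniz, hp, aeval_X, hD, Derivation.leibniz, pderiv_X]
      simp only [smul_eq_mul, map_add, map_mul, aeval_X]
      by_cases h : i = j
      · subst h; simp
      · rw [if_neg h, Pi.single_eq_of_ne (Ne.symm h)]
        simp
  -- Relations are homogeneous, and D i acts on polynomials in y as the i-th partial derivative. The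
  -- partial derivatives of a relation are thus relations of lower degree, zero by induction, and
  -- Euler's identity in characteristic zero finishes.
  have hhom : ∀ n, ∀ p : MvPolynomial ι ℂ, p.IsHomogeneous n → aeval y p = 0 → p = 0 := by
    intro n
    induction n with
    | zero =>
      intro p hp h0
      have hC := totalDegree_eq_zero_iff_eq_C.mp (Nat.le_zero.mp hp.totalDegree_le)
      rw [hC, aeval_C] at h0
      rw [hC, (map_eq_zero_iff _ (algebraMap ℂ R).injective).mp h0, C_0]
    | succ n ih =>
      intro p hp h0
      have hzero : ∀ i, pderiv i p = 0 := fun i =>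
        ih _ (by simpa using hp.pderiv (i := i)) (hinjK (by
          rw [← hpderiv, h0, map_zero, map_zero]))
      have := hp.sum_X_mul_pderiv
      simp only [hzero, mul_zero, Finset.sum_const_zero] at this
      exact (smul_eq_zero.mp this.symm).resolve_left (by omega)
  rw [injective_iff_map_eq_zero]
  intro p hp
  rw [← sum_homogeneousComponent p]
  refine Finset.sum_eq_zero fun n _ =>
    hhom n _ (homogeneousComponent_isHomogeneous n p) ?_
  rw [← proj_aeval 𝒜 hy, hp, map_zero]

end Polynomial

/-! ### Weight two: Darboux coordinates. -/

section WeightTwo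

variable {R : Type} [CommRing R] [IsDomain R] [Algebra ℂ R]
variable {𝒜 : ℕ → Submodule ℂ R} {ω : TwoForm (FractionRing R)}

theorem IsIsomorphicToStandard.not_isSingular {d : ℕ} (h : IsIsomorphicToStandard 𝒜 ω d) :
    ¬ IsSingular R := by
  obtain ⟨e, -, -⟩ := h
  have : Algebra.Smooth ℂ (AffineRing d) := ⟨inferInstance, inferInstance⟩
  have : Algebra.Smooth ℂ R := .of_equiv e.symm
  exact not_not.mpr Algebra.smoothLocus_eq_univ

variable [GradedAlgebra 𝒜]

/-- In weight two the brackets of elements of degree one are constants, and these are the values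
of a symplectic form. -/
theorem exists_symplectic_generators (hX : IsConicalSymplecticVariety 𝒜 ω)
    (hN : HasMaximalWeight 𝒜 1) (hl : HasWeight 𝒜 ω 2)
    {H : FractionRing R → VectorField (FractionRing R)} (hH : IsHamiltonian ω H) :
    ∃ (d : ℕ) (y : Fin d ⊕ Fin d → R), (∀ i, y i ∈ 𝒜 1) ∧
      Algebra.adjoin ℂ (Set.range y) = ⊤ ∧
      (∀ i j, H (algebraMap R _ (y (.inl j))) (algebraMap R _ (y (.inl i))) = 0) ∧
      (∀ i j, H (algebraMap R _ (y (.inr j))) (algebraMap R _ (y (.inr i))) = 0) ∧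
      (∀ i j, H (algebraMap R _ (y (.inr j))) (algebraMap R _ (y (.inl i))) =
        if i = j then 1 else 0) := by
  have := hX.finiteType
  have := hX.normal
  obtain ⟨s, hfin, hs1, hs, -⟩ := hN.exists_finite_degree_one 𝒜 hX.degree_zero
  let W : Submodule ℂ R := Submodule.span ℂ s
  have hW : ∀ w ∈ W, w ∈ 𝒜 1 := fun w hw => (Submodule.span_le.mpr hs1 : W ≤ 𝒜 1) hw
  have : FiniteDimensional ℂ W := .span_of_finite ℂ hfin
  let ψ : W → FractionRing R := fun w => algebraMap R (FractionRing R) w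
  have hψadd : ∀ u v, ψ (u + v) = ψ u + ψ v := fun u v => map_add _ _ _
  have hψsmul : ∀ (c : ℂ) u, ψ (c • u) = c • ψ u := fun c u =>
    map_smul (IsScalarTower.toAlgHom ℂ R (FractionRing R)) c (u : R)
  have hbr : ∀ f g : W, ∃ c : ℂ, algebraMap ℂ (FractionRing R) c = H (ψ g) (ψ f) := fun f g => by
    obtain ⟨r, hr, hdeg⟩ :=
      exists_hasDegree_eq_bracket hX.symplectic hl hH (hW g g.2) (hW f f.2)
    have hr0 := HasDegree.mem_of_algebraMap 𝒜 (k := 0) (by simpa using hdeg)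
    rw [hX.degree_zero, Submodule.mem_one] at hr0
    obtain ⟨c, rfl⟩ := hr0
    exact ⟨c, by rw [← hr, ← IsScalarTower.algebraMap_apply]⟩
  choose c hc using hbr
  have hinj := (algebraMap ℂ (FractionRing R)).injective
  -- With this order of arguments, B(f, g) is the constant H_g f = ω(H_f, H_g).
  let B : W →ₗ[ℂ] W →ₗ[ℂ] ℂ := LinearMap.mk₂ ℂ c
    (fun f f' g => hinj (by rw [map_add, hc, hc, hc, hψadd, map_add]))
    (fun a f g => hinj (by
      rw [smul_eq_mul, map_mul, hc, hc, hψsmul, Derivation.map_smul, Algebra.smul_def]))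
    (fun f g g' => hinj (by
      rw [map_add, hc, hc, hc, hψadd, hH.add, Derivation.add_apply]))
    (fun a f g => hinj (by
      rw [smul_eq_mul, map_mul, hc, hc, hψsmul, hH.smul, Derivation.smul_apply,
        Algebra.smul_def]))
  have hB : ∀ f g, algebraMap ℂ (FractionRing R) (B f g) = H (ψ g) (ψ f) := hc
  have hsW : ∀ g ∈ s, g ∈ W := fun g hg => Submodule.subset_span hg
  obtain ⟨d, b, h1, h2, h3, h4⟩ := exists_symplectic_family (F := ℂ) _ B
    (fun w => hinj (by
      rw [hB, ← hH.apply_apply, hX.symplectic.alternating, map_zero]))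
    (fun w hw => Subtype.ext (hH.eq_zero_of_forall_apply_eq_zero 𝒜 hs (hW w w.2) fun g hg => by
      have := hB w ⟨g, hsW g hg⟩
      rw [hw, map_zero, hH.swap hX.symplectic.alternating] at this
      exact neg_eq_zero.mp this.symm)) rfl
  refine ⟨d, fun x => b x, fun x => hW _ (b x).2, ?_, fun i j => ?_, fun i j => ?_,
    fun i j => ?_⟩
  · rw [eq_top_iff, ← hs]
    refine Algebra.adjoin_le fun g hg => ?_
    have hspan := congrArg (Submodule.map W.subtype) h4
    rw [Submodule.map_span, Submodule.map_top, Submodule.range_subtype, ← Set.range_comp] at hspan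
    have hgW : g ∈ W := hsW g hg
    rw [← hspan] at hgW
    exact Algebra.span_le_adjoin ℂ _ hgW
  · exact (hB _ _).symm.trans (by rw [h1, map_zero])
  · exact (hB _ _).symm.trans (by rw [h2, map_zero])
  · exact (hB _ _).symm.trans (by rw [h3]; split_ifs <;> simp)

theorem isIsomorphicToStandard_of_weight_two (hX : IsConicalSymplecticVariety 𝒜 ω)
    (hN : HasMaximalWeight 𝒜 1) (hl : HasWeight 𝒜 ω 2) :
    ∃ d, IsIsomorphicToStandard 𝒜 ω d := by
  have := hX.finiteType
  obtain ⟨H, hH⟩ := hX.symplectic.exists_hamiltonian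
  obtain ⟨d, y, hy, hgen, h1, h2, h3⟩ := exists_symplectic_generators hX hN hl hH
  let z : Fin d ⊕ Fin d → FractionRing R := fun i => algebraMap R _ (y i)
  have h4 : ∀ i j, H (z (.inl j)) (z (.inr i)) = if i = j then -1 else 0 := fun i j => by
    rw [hH.swap hX.symplectic.alternating, h3]
    by_cases h : i = j
    · rw [if_pos h, if_pos h.symm]
    · rw [if_neg h, if_neg (Ne.symm h), neg_zero]
  -- With ω(H_f, ·) = df, the partial derivative along z_i is H of z_{i+d}, and the one along
  -- z_{i+d} is minus H of z_i.
  have hinj := aeval_injective_of_dual_derivations 𝒜 hy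
    (Sum.elim (fun i => H (z (.inr i))) fun i => - H (z (.inl i))) (by
      rintro (i | i) (j | j)
      · refine (h3 j i).trans ?_
        simp [eq_comm]
      · exact (h2 j i).trans (by simp)
      · refine (congrArg Neg.neg (h1 j i)).trans (by simp)
      · refine (congrArg Neg.neg (h4 j i)).trans ?_
        by_cases h : i = j
        · subst h; simp
        · simp [h, Ne.symm h])
  have hsurj : Function.Surjective (MvPolynomial.aeval y : AffineRing d →ₐ[ℂ] R) := by
    rw [← AlgHom.range_eq_top, ← Algebra.adjoin_range_eq_range_aeval, hgen]
  let e := (AlgEquiv.ofBijective (MvPolynomial.aeval y : AffineRing d →ₐ[ℂ] R) ⟨hinj, hsurj⟩).symm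
  have he : ∀ i, e (y i) = MvPolynomial.X i := fun i =>
    (AlgEquiv.symm_apply_eq _).mpr (MvPolynomial.aeval_X y i).symm
  refine ⟨d, e, fun i f => ?_, ?_⟩
  · rw [← aeval_mem_iff_isHomogeneous 𝒜 hy hinj]
    have : MvPolynomial.aeval y (e f) = f := e.symm_apply_apply f
    rw [this]
  have hω : ∀ D D', ω D D' =
      ∑ i, (D (z (.inl i)) * D' (z (.inr i)) - D (z (.inr i)) * D' (z (.inl i))) := by
    intro D D'
    -- A field is determined by its values on generators, so it expands in the Hamiltonian fields of
    -- the coordinates; pairing this expansion with D' gives ω.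
    have hD : D = ∑ i, (D (z (.inl i)) • H (z (.inr i)) - D (z (.inr i)) • H (z (.inl i))) := by
      refine derivation_eq_of_eqOn_generators hgen ?_
      rintro _ ⟨j, rfl⟩
      have hsum : ∀ (s : Finset (Fin d)) (F : Fin d → VectorField (FractionRing R)) x,
          (∑ i ∈ s, F i) x = ∑ i ∈ s, F i x := fun s F x => by
        exact map_sum (AddMonoidHom.mk' (fun D : VectorField (FractionRing R) => D x)
          fun _ _ => rfl) F s
      rw [hsum]
      simp only [Derivation.sub_apply, Derivation.smul_apply, smul_eq_mul]
      rcases j with j | j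
      · change D (z (.inl j)) = ∑ i, (_ * H (z (.inr i)) (z (.inl j)) -
          _ * H (z (.inl i)) (z (.inl j)))
        have : ∀ i, H (z (.inl i)) (z (.inl j)) = 0 := fun i => h1 j i
        have h3' : ∀ i, H (z (.inr i)) (z (.inl j)) = if j = i then 1 else 0 := fun i => h3 j i
        simp [this, h3']
      · change D (z (.inr j)) = ∑ i, (_ * H (z (.inr i)) (z (.inr j)) -
          _ * H (z (.inl i)) (z (.inr j)))
        have : ∀ i, H (z (.inr i)) (z (.inr j)) = 0 := fun i => h2 j i
        simp [this, h4]
    conv_lhs => rw [hD]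
    rw [map_sum, LinearMap.sum_apply]
    refine Finset.sum_congr rfl fun i _ => ?_
    rw [map_sub, map_smul, map_smul, LinearMap.sub_apply, LinearMap.smul_apply,
      LinearMap.smul_apply, hH.apply_apply, hH.apply_apply, smul_eq_mul, smul_eq_mul]
  ext D D'
  set σ := IsFractionRing.fieldEquivOfAlgEquiv ℂ (FractionRing R)
    (FractionRing (AffineRing d)) e
  have hσ : ∀ i, σ (z i) = coord i := fun i => by
    rw [IsFractionRing.fieldEquivOfAlgEquiv_algebraMap, he]; rfl
  have hconj : ∀ (D : VectorField (FractionRing (AffineRing d))) i,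
      σ (conjVectorField σ D (z i)) = D (coord i) := fun D i => by
    rw [conjVectorField_apply, AlgEquiv.apply_symm_apply, hσ]
  change σ (ω (conjVectorField σ D) (conjVectorField σ D')) = _
  rw [hω, map_sum, standardForm, LinearMap.sum_apply, LinearMap.sum_apply]
  refine Finset.sum_congr rfl fun i _ => ?_
  rw [map_sub, map_mul, map_mul, hconj, hconj, hconj, hconj]
  rfl

end WeightTwo

end ConicalSymplectic

end

/-! ### Assembly of the three statements. -/

theorem proposition1 (R : Type) [CommRing R] [IsDomain R] [Algebra ℂ R]
    (𝒜 : ℕ → Submodule ℂ R) [GradedAlgebra 𝒜]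
    (ω : ConicalSymplectic.TwoForm (FractionRing R))
    (hX : ConicalSymplectic.IsConicalSymplecticVariety 𝒜 ω)
    (hN : ConicalSymplectic.HasMaximalWeight 𝒜 1)
    (l : ℤ) (hl : ConicalSymplectic.HasWeight 𝒜 ω l) :
    (l = 1 ∨ l = 2) ∧
    (l = 2 → ∃ d : ℕ, ConicalSymplectic.IsIsomorphicToStandard 𝒜 ω d) ∧
    (ConicalSymplectic.IsSingular R ↔ l = 1) := by
  have h1 := ConicalSymplectic.one_le_weight hX hN hl
  have h2 := ConicalSymplectic.weight_le_two hX hN hl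
  have hstd : l = 2 → ∃ d : ℕ, ConicalSymplectic.IsIsomorphicToStandard 𝒜 ω d := by
    rintro rfl
    exact ConicalSymplectic.isIsomorphicToStandard_of_weight_two hX hN hl
  refine ⟨by omega, hstd, fun hs => ?_, ?_⟩
  · by_contra h
    obtain ⟨d, hd⟩ := hstd (by omega)
    exact hd.not_isSingular hs
  · rintro rfl
    exact ConicalSymplectic.isSingular_of_weight_one hX hN hl
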